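/- **Bi-Free Kac/Loeve Theorem.** Let $(\mathcal A,\varphi)$ be a non-commutative probability space, i.e. a unital complex algebra $\mathcal A$ with a linear functional $\varphi:\mathcal A\to\mathbb C$, $\varphi(1)=1$. Let $T_1,S_1,T_2,S_2\in\mathcal A$ be such that the two-faced families $(T_1,S_1)$ and $(T_2,S_2)$ (with $T_k$ the left and $S_k$ the right variable) are bi-free with respect to $\varphi$. Fix $\theta\in(0,\frac{\pi}{2})$ and put \[ \begin{aligned} T_3&=\cos(\theta)\,T_1+\sin(\theta)\,T_2, & S_3&=\cos(\theta)\,S_1+\sin(\theta)\,S_2,\\ T_4&=-\sin(\theta)\,T_1+\cos(\theta)\,T_2, & S_4&=-\sin(\theta)\,S_1+\cos(\theta)\,S_2. \end{aligned} \] 1. Suppose $\varphi(T_k)=0=\varphi(S_k)$ for $k\in\{1,2\}$. If $(T_3,S_3)$ and $(T_4,S_4)$ are bi-free, then $(T_1,S_1)$ and $(T_2,S_2)$ both have bi-free central limit distributions, and their second-order $(\ell,r)$-cumulants are equal: for every $\chi:\{1,2\}\to\{\ell,r\}$, \[ \kappa_{1_\chi}(Z_{\chi(1),1},Z_{\chi(2),1})=\kappa_{1_\chi}(Z_{\chi(1),2},Z_{\chi(2),2}),\qquad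 Z_{\ell,m}=T_m,\quad Z_{r,m}=S_m. \] 2. Conversely, if $(T_1,S_1)$ and $(T_2,S_2)$ both have bi-free central limit distributions and their second-order $(\ell,r)$-cumulants are equal, then $(T_3,S_3)$ and $(T_4,S_4)$ are bi-free. Here the following standard definitions are used. * Two-faced families $(T_k,S_k)_{k\in K}$ are *bi-free* if, with $C_k$ and $D_k$ the unital subalgebras generated by $T_k$ and by $S_k$, there are complex vector spaces $\mathcal X_k=\mathbb C\oplus\mathring{\mathcal X}_k$ and unital homomorphisms $l_k:C_k\to\mathcal L(\mathcal X_k)$, $r_k:D_k\to\mathcal L(\mathcal X_k)$ such that the joint distribution of $(C_k,D_k)_{k\in K}$ with respect to $\varphi$ equals that of $(\lambda_k(l_k(C_k)),\rho_k(r_k(D_k)))_{k\in K}$ with respect to the vacuum expectation on the free product $\ast_k\mathcal X_k=\mathbb C\oplus\bigoplus_{n\ge1}\bigoplus_{k_1\ne k_2\ne\cdots\ne k_n}\mathring{\mathcal X}_{k_1}\otimes\cdots\otimes\mathring{\mathcal X}_{k_n}$, where $\lambda_k,\rho_k$ are the left and right regular representations. * $(T,S)$ has a *bi-free central limit distribution*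 if its joint distribution is the pointwise limit, as $N\to\infty$, of the joint distributions of $\bigl(N^{-1/2}\sum_{i=1}^N T^{(i)},\,N^{-1/2}\sum_{i=1}^N S^{(i)}\bigr)$ for some sequence of bi-free, identically distributed two-faced families $(T^{(i)},S^{(i)})$ with mean zero ($\varphi'(T^{(i)})=0=\varphi'(S^{(i)})$) in some non-commutative probability space $(\mathcal A',\varphi')$. * For $\chi:\{1,\dots,n\}\to\{\ell,r\}$, $BNC(\chi)$ is the set, ordered by refinement, of partitions of $\{1,\dots,n\}$ that are non-crossing for the order listing $\chi^{-1}(\ell)$ increasingly and then $\chi^{-1}(r)$ decreasingly; $1_\chi$ is the one-block partition, and $\kappa_{1_\chi}(Z_1,\dots,Z_n)=\sum_{\sigma\in BNC(\chi)}\varphi_\sigma(Z_1,\dots,Z_n)\,\mu_{BNC}(\sigma,1_\chi)$, where $\mu_{BNC}$ is the Möbius function of the poset $BNC(\chi)$ and $\varphi_\sigma$ is the product over the blocks $\{k_1<\cdots<k_m\}$ of $\sigma$ of $\varphi(Z_{k_1}\cdots Z_{k_m})$. -/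

import Mathlib

open scoped BigOperators

namespace BiFree

/-- The label of a variable: left (`ℓ`) or right (`r`). -/
inductive Side : Type
  | left : Side
  | right : Side

/-! ### Reduced free products of vector spaces with a specified vector state

A complex vector space with a specified vector state is written as `ℂ × X`, that is `ℂ ⊕ X`, with
distinguished vector `(1, 0)` and with the projection onto the first summand as state. -/

section FreeProduct

universe u v

variable {K : Type u} (X : K → Type v)

/-- Alternating words `x₁ x₂ ⋯ xₙ` (`n ≥ 0`) with `xᵢ ∈ X (kᵢ)` and `k₁ ≠ k₂ ≠ ⋯ ≠ kₙ`. -/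
abbrev AltWord : Type (max u v) :=
  {w : List (Σ k, X k) // w.IsChain (fun a b => a.1 ≠ b.1)}

/-- `AvoidLeft X k w`: the alternating word `w` does not start with a letter from `X k`. -/
def AvoidLeft (k : K) (w : AltWord X) : Prop :=
  ∀ a ∈ w.1.head?, k ≠ a.1

variable {X}

/-- The empty word. -/
def AltWord.nil : AltWord X := ⟨[], List.isChain_nil⟩

/-- Prefix a letter from `X k` to a word that does not start with a letter from `X k`. -/
def AltWord.cons {k : K} (x : X k) (w : AltWord X) (hw : AvoidLeft X k w) : AltWord X :=
  ⟨⟨k, x⟩ :: w.1, w.2.cons hw⟩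

/-- The mirror image of a word. -/
def AltWord.reverse (w : AltWord X) : AltWord X :=
  ⟨w.1.reverse, List.isChain_reverse.2 (w.2.imp fun _ _ h => h.symm)⟩

variable (X) [∀ k, AddCommGroup (X k)] [∀ k, Module ℂ (X k)]

/-- The relations saying that a word is linear in each of its letters. -/
noncomputable def multilinearRelations : Submodule ℂ (AltWord X →₀ ℂ) :=
  Submodule.span ℂ
    {f | ∃ (p q : List (Σ k, X k)) (k : K) (x y : X k) (c : ℂ) (w w₁ w₂ : AltWord X),
      w.1 = p ++ ⟨k, c • x + y⟩ :: q ∧ w₁.1 = p ++ ⟨k, x⟩ :: q ∧ w₂.1 = p ++ ⟨k, y⟩ :: q ∧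
      f = Finsupp.single w 1 - c • Finsupp.single w₁ 1 - Finsupp.single w₂ 1}

/-- The free product of the spaces `ℂ ⊕ X k`, that is
`ℂ ⊕ ⨁_{n ≥ 1} ⨁_{k₁ ≠ k₂ ≠ ⋯ ≠ kₙ} X k₁ ⊗ ⋯ ⊗ X kₙ`, the tensor products being presented by
generators (the alternating words, standing for `x₁ ⊗ ⋯ ⊗ xₙ`) and the multilinearity relations;
the summand `ℂ` is spanned by the empty word. -/
abbrev FreeProd : Type (max u v) :=
  (AltWord X →₀ ℂ) ⧸ multilinearRelations X

variable {X}

/-- The elementary tensor `x₁ ⊗ ⋯ ⊗ xₙ` given by an alternating word. -/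
noncomputable def FreeProd.word (w : AltWord X) : FreeProd X :=
  (multilinearRelations X).mkQ (Finsupp.single w 1)

theorem FreeProd.word_eq {p q : List (Σ k, X k)} {k : K} {x y : X k} {c : ℂ}
    {w w₁ w₂ : AltWord X} (h : w.1 = p ++ ⟨k, c • x + y⟩ :: q)
    (h₁ : w₁.1 = p ++ ⟨k, x⟩ :: q) (h₂ : w₂.1 = p ++ ⟨k, y⟩ :: q) :
    FreeProd.word w = c • FreeProd.word w₁ + FreeProd.word w₂ := by
  have hm : Finsupp.single w 1 - c • Finsupp.single w₁ 1 - Finsupp.single w₂ 1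
      ∈ multilinearRelations X :=
    Submodule.subset_span ⟨p, q, k, x, y, c, w, w₁, w₂, h, h₁, h₂, rfl⟩
  have h0 := (Submodule.Quotient.mk_eq_zero (multilinearRelations X)).2 hm
  rw [Submodule.Quotient.mk_sub, Submodule.Quotient.mk_sub, Submodule.Quotient.mk_smul,
    sub_sub, sub_eq_zero] at h0
  exact h0

theorem multilinearRelations_le_ker {M : Type*} [AddCommGroup M] [Module ℂ M] (F : AltWord X → M)
    (hF : ∀ (p q : List (Σ k, X k)) (k : K) (x y : X k) (c : ℂ) (w w₁ w₂ : AltWord X),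
      w.1 = p ++ ⟨k, c • x + y⟩ :: q → w₁.1 = p ++ ⟨k, x⟩ :: q → w₂.1 = p ++ ⟨k, y⟩ :: q →
      F w = c • F w₁ + F w₂) :
    multilinearRelations X ≤ (Finsupp.linearCombination ℂ F).ker := by
  refine Submodule.span_le.2 ?_
  rintro f ⟨p, q, k, x, y, c, w, w₁, w₂, h, h₁, h₂, rfl⟩
  simp [hF p q k x y c w w₁ w₂ h h₁ h₂]

/-- A map on alternating words that is linear in each letter extends to the free product. -/
noncomputable def FreeProd.lift {M : Type*} [AddCommGroup M] [Module ℂ M] (F : AltWord X → M)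
    (hF : ∀ (p q : List (Σ k, X k)) (k : K) (x y : X k) (c : ℂ) (w w₁ w₂ : AltWord X),
      w.1 = p ++ ⟨k, c • x + y⟩ :: q → w₁.1 = p ++ ⟨k, x⟩ :: q → w₂.1 = p ++ ⟨k, y⟩ :: q →
      F w = c • F w₁ + F w₂) :
    FreeProd X →ₗ[ℂ] M :=
  (multilinearRelations X).liftQ (Finsupp.linearCombination ℂ F)
    (multilinearRelations_le_ker F hF)

@[simp] theorem FreeProd.lift_word {M : Type*} [AddCommGroup M] [Module ℂ M] (F : AltWord X → M)
    (hF) (w : AltWord X) : FreeProd.lift F hF (FreeProd.word w) = F w := by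
  unfold FreeProd.lift FreeProd.word
  rw [Submodule.mkQ_apply, Submodule.liftQ_apply, Finsupp.linearCombination_single, one_smul]

/-- The vacuum vector: the empty word. -/
noncomputable def FreeProd.vacuum : FreeProd X := FreeProd.word AltWord.nil

/-- The projection of the free product onto its summand `ℂ`. -/
noncomputable def FreeProd.proj : FreeProd X →ₗ[ℂ] ℂ :=
  FreeProd.lift (fun w => if w.1 = [] then 1 else 0) (by
    intro p q k x y c w w₁ w₂ h h₁ h₂
    simp [h, h₁, h₂])

/-- The vacuum expectation `Z ↦ p (Z Ω)` on the linear operators on the free product. -/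
noncomputable def FreeProd.expect (Z : Module.End ℂ (FreeProd X)) : ℂ :=
  FreeProd.proj (Z FreeProd.vacuum)

/-- The reversal `x₁ ⊗ ⋯ ⊗ xₙ ↦ xₙ ⊗ ⋯ ⊗ x₁`. -/
noncomputable def FreeProd.rev : FreeProd X →ₗ[ℂ] FreeProd X :=
  FreeProd.lift (fun w => FreeProd.word w.reverse) (by
    intro p q k x y c w w₁ w₂ h h₁ h₂
    apply FreeProd.word_eq (p := q.reverse) (q := p.reverse) (k := k) (x := x) (y := y) <;>
      simp [AltWord.reverse, h, h₁, h₂])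

/-- For `x = (a, x') ∈ ℂ ⊕ X k` and a word `w` that does not start in `X k`, the vector
`a w + x' ⊗ w`; this is the identification of `(ℂ ⊕ X k) ⊗ (words not starting in X k)` with the
free product. -/
noncomputable def FreeProd.joinLeft {k : K} (x : ℂ × X k) (w : AltWord X)
    (hw : AvoidLeft X k w) : FreeProd X :=
  x.1 • FreeProd.word w + FreeProd.word (AltWord.cons x.2 w hw)

theorem FreeProd.joinLeft_lin {k : K} (c : ℂ) (x y : ℂ × X k) (w : AltWord X)
    (hw : AvoidLeft X k w) :
    FreeProd.joinLeft (c • x + y) w hw =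
      c • FreeProd.joinLeft x w hw + FreeProd.joinLeft y w hw := by
  have h : FreeProd.word (AltWord.cons (c • x.2 + y.2) w hw) =
      c • FreeProd.word (AltWord.cons x.2 w hw) + FreeProd.word (AltWord.cons y.2 w hw) :=
    FreeProd.word_eq (p := []) (q := w.1) rfl rfl rfl
  simp only [FreeProd.joinLeft, Prod.fst_add, Prod.snd_add, Prod.smul_fst, Prod.smul_snd, h,
    add_smul, smul_add, smul_assoc]
  abel

theorem FreeProd.joinLeft_word_lin {j : K} (z : ℂ × X j) {p q : List (Σ k, X k)} {k : K}
    {x y : X k} {c : ℂ} {w w₁ w₂ : AltWord X} (h : w.1 = p ++ ⟨k, c • x + y⟩ :: q)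
    (h₁ : w₁.1 = p ++ ⟨k, x⟩ :: q) (h₂ : w₂.1 = p ++ ⟨k, y⟩ :: q) (hw : AvoidLeft X j w)
    (hw₁ : AvoidLeft X j w₁) (hw₂ : AvoidLeft X j w₂) :
    FreeProd.joinLeft z w hw = c • FreeProd.joinLeft z w₁ hw₁ + FreeProd.joinLeft z w₂ hw₂ := by
  have e : FreeProd.word (AltWord.cons z.2 w hw) =
      c • FreeProd.word (AltWord.cons z.2 w₁ hw₁) + FreeProd.word (AltWord.cons z.2 w₂ hw₂) :=
    FreeProd.word_eq (p := ⟨j, z.2⟩ :: p) (q := q) (x := x) (y := y) (by simp [AltWord.cons, h])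
      (by simp [AltWord.cons, h₁]) (by simp [AltWord.cons, h₂])
  simp only [FreeProd.joinLeft, FreeProd.word_eq h h₁ h₂, e, smul_add, smul_comm z.1 c]
  abel

open Classical in
/-- The action of `T ⊗ 1` on words, for a linear operator `T` on `ℂ ⊕ X k`: a word `x ⊗ u` with
`x ∈ X k` is sent to `(T (0, x)) ⊗ u`, and a word `w` not starting in `X k` to `(T (1, 0)) ⊗ w`. -/
noncomputable def leftRepWord (k : K) (T : Module.End ℂ (ℂ × X k)) : AltWord X → FreeProd X
  | ⟨[], _⟩ => FreeProd.joinLeft (T (1, 0)) AltWord.nil (by simp [AvoidLeft, AltWord.nil])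
  | ⟨⟨j, x⟩ :: u, h⟩ =>
    if hj : j = k then
      FreeProd.joinLeft (T (0, hj ▸ x)) ⟨u, (List.isChain_cons.1 h).2⟩
        (by subst hj; exact (List.isChain_cons.1 h).1)
    else
      FreeProd.joinLeft (T (1, 0)) ⟨⟨j, x⟩ :: u, h⟩
        (by intro a ha; simp at ha; subst ha; exact fun e => hj e.symm)

theorem leftRepWord_lin (k : K) (T : Module.End ℂ (ℂ × X k)) (p q : List (Σ k, X k)) (j : K)
    (x y : X j) (c : ℂ) (w w₁ w₂ : AltWord X) (h : w.1 = p ++ ⟨j, c • x + y⟩ :: q)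
    (h₁ : w₁.1 = p ++ ⟨j, x⟩ :: q) (h₂ : w₂.1 = p ++ ⟨j, y⟩ :: q) :
    leftRepWord k T w = c • leftRepWord k T w₁ + leftRepWord k T w₂ := by
  obtain ⟨w, hw⟩ := w
  obtain ⟨w₁, hw₁⟩ := w₁
  obtain ⟨w₂, hw₂⟩ := w₂
  simp only at h h₁ h₂
  subst h h₁ h₂
  cases p with
  | nil =>
    simp only [List.nil_append, leftRepWord]
    split_ifs with hj
    · subst hj
      have e : T (0, c • x + y) = c • T (0, x) + T (0, y) := by
        rw [← map_smul, ← map_add]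
        simp
      exact (congrArg (fun z => FreeProd.joinLeft z _ _) e).trans
        (FreeProd.joinLeft_lin c _ _ _ _)
    · exact FreeProd.joinLeft_word_lin _ (p := []) rfl rfl rfl _ _ _
  | cons a p =>
    obtain ⟨i, z⟩ := a
    simp only [List.cons_append, leftRepWord]
    split_ifs with hj
    · exact FreeProd.joinLeft_word_lin _ (p := p) rfl rfl rfl _ _ _
    · exact FreeProd.joinLeft_word_lin _ (p := ⟨i, z⟩ :: p) rfl rfl rfl _ _ _

/-- The left regular representation `λ_k` of the linear operators on `ℂ ⊕ X k`. -/
noncomputable def leftRep (k : K) (T : Module.End ℂ (ℂ × X k)) : Module.End ℂ (FreeProd X) :=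
  FreeProd.lift (leftRepWord k T) (leftRepWord_lin k T)

/-- The right regular representation `ρ_k`: the operator acts on the last tensor factor. It is the
mirror image of `λ_k`. -/
noncomputable def rightRep (k : K) (T : Module.End ℂ (ℂ × X k)) : Module.End ℂ (FreeProd X) :=
  FreeProd.rev ∘ₗ leftRep k T ∘ₗ FreeProd.rev

end FreeProduct

/-! ### Bi-freeness -/

section BiFreeness

universe u

variable {K : Type*} {A : Type u} [Ring A] [Algebra ℂ A]

/-- The joint distribution of a family of pairs of faces `(C k, D k)` is determined by the
expectations of products of finitely many elements, each taken from a left face `C k` or a right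
face `D k`. Such a product is given by the list of its factors. -/
abbrev FaceWord (C D : K → Subalgebra ℂ A) : Type _ := List (Σ k, (C k) ⊕ (D k))

/-- A factor, as an element of `A`. -/
def faceElement {C D : K → Subalgebra ℂ A} : (Σ k, (C k) ⊕ (D k)) → A
  | ⟨_, Sum.inl c⟩ => c
  | ⟨_, Sum.inr d⟩ => d

/-- The image of a factor on the free product: `λ_k (l_k c)` for `c` in the left face `C k`, and
`ρ_k (r_k d)` for `d` in the right face `D k`. -/
noncomputable def faceOperator {C D : K → Subalgebra ℂ A} {X : K → Type u}
    [∀ k, AddCommGroup (X k)] [∀ k, Module ℂ (X k)]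
    (l : ∀ k, C k →ₐ[ℂ] Module.End ℂ (ℂ × X k)) (r : ∀ k, D k →ₐ[ℂ] Module.End ℂ (ℂ × X k)) :
    (Σ k, (C k) ⊕ (D k)) → Module.End ℂ (FreeProd X)
  | ⟨k, Sum.inl c⟩ => leftRep k (l k c)
  | ⟨k, Sum.inr d⟩ => rightRep k (r k d)

/-- Bi-freeness of the family of pairs of faces `(C k, D k)` in `(A, φ)`: the joint distribution of
the family is that of left and right representations on a free product of vector spaces with
specified vector states. -/
def IsBiFree (φ : A →ₗ[ℂ] ℂ) (C D : K → Subalgebra ℂ A) : Prop :=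
  ∃ (X : K → Type u) (_ : ∀ k, AddCommGroup (X k)) (_ : ∀ k, Module ℂ (X k))
    (l : ∀ k, C k →ₐ[ℂ] Module.End ℂ (ℂ × X k)) (r : ∀ k, D k →ₐ[ℂ] Module.End ℂ (ℂ × X k)),
    ∀ w : FaceWord C D,
      φ (w.map faceElement).prod = FreeProd.expect (w.map (faceOperator l r)).prod

/-- Bi-freeness of the two-faced families `(T k, S k)`: the pairs formed by the unital algebra
generated by `T k` (left face) and the one generated by `S k` (right face) are bi-free. -/
def IsBiFreeFamily (φ : A →ₗ[ℂ] ℂ) (T S : K → A) : Prop :=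
  IsBiFree φ (fun k => Algebra.adjoin ℂ {T k}) (fun k => Algebra.adjoin ℂ {S k})

/-- The operator `T` for `ℓ` and `S` for `r`. -/
def twoFaced (T S : A) : Side → A
  | Side.left => T
  | Side.right => S

/-- The joint distribution of `(T, S)` in `(A, φ)`: the linear functional `P ↦ φ (P (T, S))` on
polynomials in two non-commuting variables. -/
noncomputable def jointDistribution (φ : A →ₗ[ℂ] ℂ) (T S : A) : FreeAlgebra ℂ Side →ₗ[ℂ] ℂ :=
  φ ∘ₗ (FreeAlgebra.lift ℂ (twoFaced T S)).toLinearMap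

/-- `(T, S)` has a bi-free central limit distribution: its joint distribution is the limit, as
`N → ∞`, of the joint distributions of `N^{-1/2} ∑_{i < N} (Tᵢ, Sᵢ)` for a sequence of bi-free,
identically distributed, centred two-faced families `(Tᵢ, Sᵢ)` in some non-commutative probability
space. -/
def IsBiFreeCentralLimit (φ : A →ₗ[ℂ] ℂ) (T S : A) : Prop :=
  ∃ (A' : Type u) (_ : Ring A') (_ : Algebra ℂ A') (φ' : A' →ₗ[ℂ] ℂ) (T' S' : ℕ → A'),
    φ' 1 = 1 ∧ IsBiFreeFamily φ' T' S' ∧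
    (∀ i, jointDistribution φ' (T' i) (S' i) = jointDistribution φ' (T' 0) (S' 0)) ∧
    (∀ i, φ' (T' i) = 0 ∧ φ' (S' i) = 0) ∧
    ∀ P : FreeAlgebra ℂ Side,
      Filter.Tendsto
        (fun N : ℕ => jointDistribution φ'
          (((Real.sqrt N : ℝ) : ℂ)⁻¹ • ∑ i ∈ Finset.range N, T' i)
          (((Real.sqrt N : ℝ) : ℂ)⁻¹ • ∑ i ∈ Finset.range N, S' i) P)
        Filter.atTop (nhds (jointDistribution φ T S P))

end BiFreeness

/-! ### Bi-non-crossing partitions and `(ℓ, r)`-cumulants -/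

section Cumulants

/-- The order `≺_χ`: the left indices in increasing order, followed by the right indices in
decreasing order. -/
def chiLT {n : ℕ} (χ : Fin n → Side) (a b : Fin n) : Prop :=
  match χ a, χ b with
  | Side.left, Side.left => a < b
  | Side.left, Side.right => True
  | Side.right, Side.left => False
  | Side.right, Side.right => b < a

/-- Bi-non-crossing partitions with respect to `χ`. -/
def IsBiNonCrossing {n : ℕ} (χ : Fin n → Side)
    (π : Finpartition (Finset.univ : Finset (Fin n))) : Prop :=
  ∀ U ∈ π.parts, ∀ V ∈ π.parts, ∀ u₁ ∈ U, ∀ u₂ ∈ U, ∀ v₁ ∈ V, ∀ v₂ ∈ V,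
    chiLT χ u₁ v₁ → chiLT χ v₁ u₂ → chiLT χ u₂ v₂ → U = V

/-- The set `BNC(χ)`, ordered by refinement. -/
abbrev BNC {n : ℕ} (χ : Fin n → Side) : Type :=
  {π : Finpartition (Finset.univ : Finset (Fin n)) // IsBiNonCrossing χ π}

noncomputable instance {n : ℕ} (χ : Fin n → Side) : Fintype (BNC χ) := Fintype.ofFinite _

noncomputable instance {n : ℕ} (χ : Fin n → Side) : DecidableEq (BNC χ) := Classical.decEq _

open Classical in
noncomputable instance {n : ℕ} (χ : Fin n → Side) : LocallyFiniteOrder (BNC χ) :=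
  Fintype.toLocallyFiniteOrder

/-- The one-block partition `1_χ`. -/
def BNC.one {n : ℕ} (χ : Fin n → Side) : BNC χ :=
  ⟨⊤, fun _ hU _ hV _ _ _ _ _ _ _ _ _ _ _ => Finpartition.parts_top_subsingleton _ hU hV⟩

/-- The bi-non-crossing Möbius function. -/
noncomputable def muBNC {n : ℕ} {χ : Fin n → Side} (σ π : BNC χ) : ℂ :=
  IncidenceAlgebra.mu ℂ σ π

variable {A : Type*} [Ring A] [Algebra ℂ A]

/-- `φ_π (Z₁, …, Zₙ)`: the product over the blocks `{k₁ < ⋯ < kₘ}` of `π` of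
`φ (Z_{k₁} ⋯ Z_{kₘ})`. -/
noncomputable def momentPart (φ : A →ₗ[ℂ] ℂ) {n : ℕ} {χ : Fin n → Side} (π : BNC χ)
    (Z : Fin n → A) : ℂ :=
  ∏ V ∈ π.1.parts, φ ((V.sort (· ≤ ·)).map Z).prod

open Classical in
/-- The `(ℓ, r)`-cumulant `κ_π (Z₁, …, Zₙ)`. -/
noncomputable def cumulant (φ : A →ₗ[ℂ] ℂ) {n : ℕ} {χ : Fin n → Side} (π : BNC χ)
    (Z : Fin n → A) : ℂ :=
  ∑ σ : BNC χ with σ ≤ π, momentPart φ σ Z * muBNC σ π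

/-- `(T₁, S₁)` and `(T₂, S₂)` have equal second-order `(ℓ, r)`-cumulants: for each
`χ ∈ {ℓ, r}²`, the cumulants `κ_{1_χ}` of the corresponding entries agree. -/
def EqualSecondCumulants (φ : A →ₗ[ℂ] ℂ) (T₁ S₁ T₂ S₂ : A) : Prop :=
  ∀ χ : Fin 2 → Side,
    cumulant φ (BNC.one χ) (fun i => twoFaced T₁ S₁ (χ i)) =
      cumulant φ (BNC.one χ) (fun i => twoFaced T₂ S₂ (χ i))

end Cumulants

end BiFree

/-! The proof works with moments only and replaces cumulant machinery by a comparison principle. In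
a bi-free family a mixed moment is determined by the marginal moments, and a colour occurring `d`
times enters only through its marginal moments of order at most `d` (`modelMoment_congr`,
`IsBiFreeMoment.congr_id`).

The reference object is the Gaussian family: sums of creation and annihilation operators on a full
Fock space, acting from the left or from the right, with a prescribed covariance. Linear
combinations of such fields are again fields, with the transformed covariance (`fockMoment_eq_sum`),
and a covariance vanishing between different colours gives a bi-free family (`fockMoment_blockCov`).
Hence a bi-free family of Gaussian pairs with common covariance is invariant under rotations
(`fockMoment_rotated`), and a normalized sum of such pairs is again Gaussian
(`gaussMoment_normalized`).

Comparing a centred, identically distributed bi-free sequence with the Gaussian one of the same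
covariance gives the central limit theorem (`tendsto_moment_normalized`). Central limit
distributions are therefore exactly the Gaussian ones, and the converse half of the theorem is
rotation invariance.

For the direct half, suppose that all marginal moments of order below `n` are Gaussian. A rotated
moment of order `n` using both colours is then Gaussian by the comparison principle. Expanding it in
the original variables leaves a linear relation between the two unknown deviations of order `n`
(`rotation_relation`). For `n ≥ 3` two such relations force both deviations to vanish. For `n = 2`
the covariance is chosen so that one deviation is zero, and one relation removes the other. -/

namespace BiFree

set_option linter.unusedSectionVars false

/-! ### Free products: representations on elementary tensors -/

section FreeProductLemmas

universe u v

variable {K : Type u} {X : K → Type v} [∀ k, AddCommGroup (X k)] [∀ k, Module ℂ (X k)]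

theorem FreeProd.ext_word {M : Type*} [AddCommGroup M] [Module ℂ M] {f g : FreeProd X →ₗ[ℂ] M}
    (h : ∀ w, f (FreeProd.word w) = g (FreeProd.word w)) : f = g := by
  refine Submodule.linearMap_qext _ (Finsupp.lhom_ext' fun w => LinearMap.ext_ring ?_)
  exact h w

theorem leftRep_cons (k : K) (T : Module.End ℂ (ℂ × X k)) (x : X k) (w : AltWord X)
    (hw : AvoidLeft X k w) :
    leftRep k T (FreeProd.word (AltWord.cons x w hw)) = FreeProd.joinLeft (T (0, x)) w hw := by
  rw [leftRep, FreeProd.lift_word]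
  simp [AltWord.cons, leftRepWord]

theorem leftRep_of_avoid (k : K) (T : Module.End ℂ (ℂ × X k)) (w : AltWord X)
    (hw : AvoidLeft X k w) :
    leftRep k T (FreeProd.word w) = FreeProd.joinLeft (T (1, 0)) w hw := by
  rw [leftRep, FreeProd.lift_word]
  obtain ⟨w, h⟩ := w
  cases w with
  | nil => rfl
  | cons q w =>
    obtain ⟨j, x⟩ := q
    have hj : j ≠ k := fun e => hw ⟨j, x⟩ (by simp) e.symm
    simp [leftRepWord, hj]

theorem FreeProd.word_cons_zero {k : K} (w : AltWord X) (hw : AvoidLeft X k w) :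
    FreeProd.word (AltWord.cons (0 : X k) w hw) = 0 := by
  have h := FreeProd.word_eq (X := X) (p := []) (q := w.1) (k := k) (x := 0) (y := 0) (c := 1)
    (w := AltWord.cons 0 w hw) (w₁ := AltWord.cons 0 w hw) (w₂ := AltWord.cons 0 w hw)
    (by simp [AltWord.cons]) rfl rfl
  simpa using h

theorem FreeProd.joinLeft_one {k : K} (w : AltWord X) (hw : AvoidLeft X k w) :
    FreeProd.joinLeft (1, 0) w hw = FreeProd.word w := by
  simp [FreeProd.joinLeft, FreeProd.word_cons_zero]

theorem FreeProd.joinLeft_zero {k : K} (x : X k) (w : AltWord X) (hw : AvoidLeft X k w) :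
    FreeProd.joinLeft (0, x) w hw = FreeProd.word (AltWord.cons x w hw) := by
  simp [FreeProd.joinLeft]

theorem AltWord.avoid_or_cons (k : K) (w : AltWord X) :
    AvoidLeft X k w ∨ ∃ (x : X k) (u : AltWord X) (hu : AvoidLeft X k u),
      w = AltWord.cons x u hu := by
  obtain ⟨w, h⟩ := w
  cases w with
  | nil => left; simp [AvoidLeft]
  | cons q w =>
    obtain ⟨j, x⟩ := q
    by_cases hj : j = k
    · subst hj
      exact Or.inr ⟨x, ⟨w, (List.isChain_cons.1 h).2⟩, (List.isChain_cons.1 h).1, rfl⟩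
    · left
      intro a ha
      simp at ha
      subst ha
      exact fun e => hj e.symm

/-- Linear maps on the free product agree when they agree on the vectors `z ⊗ u` with
`z ∈ ℂ ⊕ X k` and `u` not starting in `X k`. -/
theorem FreeProd.ext_joinLeft (k : K) {M : Type*} [AddCommGroup M] [Module ℂ M]
    {f g : FreeProd X →ₗ[ℂ] M}
    (h : ∀ (z : ℂ × X k) (u : AltWord X) (hu : AvoidLeft X k u),
      f (FreeProd.joinLeft z u hu) = g (FreeProd.joinLeft z u hu)) : f = g := by
  refine FreeProd.ext_word fun w => ?_
  rcases AltWord.avoid_or_cons k w with hw | ⟨x, u, hu, rfl⟩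
  · rw [← FreeProd.joinLeft_one w hw, h]
  · rw [← FreeProd.joinLeft_zero, h]

theorem leftRep_joinLeft (k : K) (T : Module.End ℂ (ℂ × X k)) (z : ℂ × X k) (w : AltWord X)
    (hw : AvoidLeft X k w) :
    leftRep k T (FreeProd.joinLeft z w hw) = FreeProd.joinLeft (T z) w hw := by
  have hz : z = z.1 • (1, 0) + (0, z.2) := by ext <;> simp
  conv_rhs => rw [hz, map_add, map_smul, FreeProd.joinLeft_lin]
  rw [FreeProd.joinLeft, map_add, map_smul, leftRep_of_avoid k T w hw, leftRep_cons]

theorem FreeProd.joinLeft_add {k : K} (x y : ℂ × X k) (w : AltWord X) (hw : AvoidLeft X k w) :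
    FreeProd.joinLeft (x + y) w hw = FreeProd.joinLeft x w hw + FreeProd.joinLeft y w hw := by
  simpa using FreeProd.joinLeft_lin 1 x y w hw

theorem FreeProd.joinLeft_smul {k : K} (c : ℂ) (x : ℂ × X k) (w : AltWord X)
    (hw : AvoidLeft X k w) :
    FreeProd.joinLeft (c • x) w hw = c • FreeProd.joinLeft x w hw := by
  have h0 : FreeProd.joinLeft (0 : ℂ × X k) w hw = 0 := by
    simpa using FreeProd.joinLeft_lin (-1) (0 : ℂ × X k) 0 w hw
  simpa [h0] using FreeProd.joinLeft_lin c x 0 w hw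

/-- The left regular representation as an algebra homomorphism. -/
noncomputable def leftRepHom (k : K) : Module.End ℂ (ℂ × X k) →ₐ[ℂ] Module.End ℂ (FreeProd X) :=
  AlgHom.ofLinearMap
    { toFun := leftRep k
      map_add' := fun S T => FreeProd.ext_joinLeft k fun z u hu => by
        simp only [LinearMap.add_apply, leftRep_joinLeft, FreeProd.joinLeft_add]
      map_smul' := fun c T => FreeProd.ext_joinLeft k fun z u hu => by
        simp only [LinearMap.smul_apply, leftRep_joinLeft, FreeProd.joinLeft_smul,
          RingHom.id_apply] }
    (FreeProd.ext_joinLeft k fun z u hu => by simp [leftRep_joinLeft])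
    (fun S T => FreeProd.ext_joinLeft k fun z u hu => by simp [leftRep_joinLeft])

theorem leftRepHom_apply (k : K) (T : Module.End ℂ (ℂ × X k)) : leftRepHom k T = leftRep k T :=
  rfl

theorem FreeProd.rev_word (w : AltWord X) :
    FreeProd.rev (FreeProd.word w) = FreeProd.word w.reverse := by
  rw [FreeProd.rev, FreeProd.lift_word]

theorem AltWord.reverse_reverse (w : AltWord X) : w.reverse.reverse = w :=
  Subtype.ext (List.reverse_reverse _)

theorem FreeProd.rev_comp_rev : (FreeProd.rev (X := X)) ∘ₗ FreeProd.rev = LinearMap.id :=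
  FreeProd.ext_word fun w => by simp [FreeProd.rev_word, AltWord.reverse_reverse]

theorem FreeProd.rev_rev (x : FreeProd X) : FreeProd.rev (FreeProd.rev x) = x :=
  LinearMap.congr_fun FreeProd.rev_comp_rev x

/-- The right regular representation as an algebra homomorphism. -/
noncomputable def rightRepHom (k : K) : Module.End ℂ (ℂ × X k) →ₐ[ℂ] Module.End ℂ (FreeProd X) :=
  AlgHom.ofLinearMap
    { toFun := rightRep k
      map_add' := fun S T => by
        ext x
        simp only [rightRep, ← leftRepHom_apply, map_add, LinearMap.comp_apply,
          LinearMap.add_apply]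
      map_smul' := fun c T => by
        ext x
        simp only [rightRep, ← leftRepHom_apply, map_smul, LinearMap.comp_apply,
          LinearMap.smul_apply, RingHom.id_apply] }
    (LinearMap.ext fun x => by
      simp [rightRep, ← leftRepHom_apply, FreeProd.rev_rev])
    (fun S T => LinearMap.ext fun x => by
      simp [rightRep, ← leftRepHom_apply, FreeProd.rev_rev])

theorem rightRepHom_apply (k : K) (T : Module.End ℂ (ℂ × X k)) :
    rightRepHom k T = rightRep k T :=
  rfl

theorem FreeProd.proj_word (w : AltWord X) :
    FreeProd.proj (FreeProd.word w) = if w.1 = [] then 1 else 0 := by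
  rw [FreeProd.proj, FreeProd.lift_word]

theorem avoidLeft_nil (k : K) : AvoidLeft X k AltWord.nil := by
  simp [AvoidLeft, AltWord.nil]

/-- Reversal fixes tensors with at most one letter, so left and right representations agree there.
This is why marginal moments can be computed inside `ℂ ⊕ X k`. -/
theorem rightRep_joinLeft_nil (k : K) (T : Module.End ℂ (ℂ × X k)) (z : ℂ × X k) :
    rightRep k T (FreeProd.joinLeft z AltWord.nil (avoidLeft_nil k)) =
      FreeProd.joinLeft (T z) AltWord.nil (avoidLeft_nil k) := by
  have h : ∀ z : ℂ × X k, FreeProd.rev (FreeProd.joinLeft z AltWord.nil (avoidLeft_nil k)) =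
      FreeProd.joinLeft z AltWord.nil (avoidLeft_nil k) := by
    intro z
    rw [FreeProd.joinLeft, map_add, map_smul, FreeProd.rev_word, FreeProd.rev_word]
    rfl
  simp only [rightRep, LinearMap.comp_apply, h, leftRep_joinLeft]

end FreeProductLemmas

/-! ### Moments of a bi-free product -/

section Model

universe u v

/-- The vector obtained by applying a word in two operators to the distinguished vector. -/
noncomputable def orbit {Y : Type*} [AddCommGroup Y] [Module ℂ Y]
    (a : Side → Module.End ℂ (ℂ × Y)) (u : List Side) : ℂ × Y :=
  (u.map a).prod (1, 0)

theorem orbit_nil {Y : Type*} [AddCommGroup Y] [Module ℂ Y]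
    (a : Side → Module.End ℂ (ℂ × Y)) : orbit a [] = (1, 0) := by
  simp [orbit]

theorem orbit_cons {Y : Type*} [AddCommGroup Y] [Module ℂ Y]
    (a : Side → Module.End ℂ (ℂ × Y)) (t : Side) (u : List Side) :
    orbit a (t :: u) = a t (orbit a u) := by
  simp [orbit]

/-- The centred part of a vector `ξ` is `ξ` minus a multiple of the distinguished vector. The
formula keeps the span of centred orbit vectors stable under the operators, with a marginal moment
as the only coefficient. -/
theorem apply_orbit_snd {Y : Type*} [AddCommGroup Y] [Module ℂ Y]
    (a : Side → Module.End ℂ (ℂ × Y)) (t : Side) (u : List Side) :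
    a t (0, (orbit a u).2) = (-(orbit a u).1) • orbit a [t] + orbit a (t :: u) := by
  rw [orbit_cons, orbit_cons, orbit_nil, ← map_smul, ← map_add]
  congr 1
  ext <;> simp

variable {K : Type u} {X : K → Type v} [∀ k, AddCommGroup (X k)] [∀ k, Module ℂ (X k)]

/-- The left and right operators on a free product that come from a pair of operators on each
`ℂ ⊕ X k`. -/
noncomputable def modelOp (a : ∀ k, Side → Module.End ℂ (ℂ × X k)) :
    K × Side → Module.End ℂ (FreeProd X)
  | (k, Side.left) => leftRep k (a k Side.left)
  | (k, Side.right) => rightRep k (a k Side.right)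

/-- The vacuum moments of the operators `modelOp a`. -/
noncomputable def modelMoment (a : ∀ k, Side → Module.End ℂ (ℂ × X k)) (w : List (K × Side)) : ℂ :=
  FreeProd.expect (w.map (modelOp a)).prod

theorem modelOp_joinLeft_nil (a : ∀ k, Side → Module.End ℂ (ℂ × X k)) (k : K) (t : Side)
    (z : ℂ × X k) :
    modelOp a (k, t) (FreeProd.joinLeft z AltWord.nil (avoidLeft_nil k)) =
      FreeProd.joinLeft (a k t z) AltWord.nil (avoidLeft_nil k) := by
  cases t
  · exact leftRep_joinLeft _ _ _ _ _
  · exact rightRep_joinLeft_nil _ _ _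

theorem modelMoment_map_mk (a : ∀ k, Side → Module.End ℂ (ℂ × X k)) (k : K) (u : List Side) :
    modelMoment a (u.map (Prod.mk k)) = (orbit (a k) u).1 := by
  have h : ∀ u : List Side, ((u.map (Prod.mk k)).map (modelOp a)).prod FreeProd.vacuum =
      FreeProd.joinLeft (orbit (a k) u) AltWord.nil (avoidLeft_nil k) := by
    intro u
    induction u with
    | nil => simp [orbit_nil, FreeProd.joinLeft_one, FreeProd.vacuum]
    | cons t u ih =>
      rw [orbit_cons, List.map_cons, List.map_cons, List.prod_cons, Module.End.mul_apply, ih,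
        modelOp_joinLeft_nil]
  rw [modelMoment, FreeProd.expect, h, FreeProd.joinLeft, map_add, map_smul, FreeProd.proj_word,
    FreeProd.proj_word]
  simp [AltWord.nil, AltWord.cons]

end Model

/-! ### Mixed moments are determined by marginal moments -/

section Universality

universe u v u' v'

variable {K : Type u} {X : K → Type v} [∀ k, AddCommGroup (X k)] [∀ k, Module ℂ (X k)]
variable {K' : Type u'} {X' : K' → Type v'} [∀ k, AddCommGroup (X' k)] [∀ k, Module ℂ (X' k)]

open Classical in
/-- The total length of the labels of colour `k`. -/
noncomputable def shapeDegree (k : K) (s : List (K × List Side)) : ℕ :=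
  (s.map fun q => if q.1 = k then q.2.length else 0).sum

/-- The tensors `x₁ ⊗ ⋯ ⊗ xₙ` and `x'₁ ⊗ ⋯ ⊗ x'ₙ` whose letters are obtained by applying the same
words to the distinguished vectors. -/
def ShapePair (a : ∀ k, Side → Module.End ℂ (ℂ × X k)) (a' : ∀ k, Side → Module.End ℂ (ℂ × X' k))
    (σ : K → K') (s : List (K × List Side)) (w : AltWord X) (w' : AltWord X') : Prop :=
  w.1 = s.map (fun q => ⟨q.1, (orbit (a q.1) q.2).2⟩) ∧
    w'.1 = s.map (fun q => ⟨σ q.1, (orbit (a' (σ q.1)) q.2).2⟩)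

/-- The span of the pairs of tensors of equal shape, with bounded degrees. -/
noncomputable def shapeSpan (a : ∀ k, Side → Module.End ℂ (ℂ × X k))
    (a' : ∀ k, Side → Module.End ℂ (ℂ × X' k)) (σ : K → K') (c : K → ℕ) :
    Submodule ℂ (FreeProd X × FreeProd X') :=
  Submodule.span ℂ {v | ∃ s w w', ShapePair a a' σ s w w' ∧ (∀ k, shapeDegree k s ≤ c k) ∧
    v = (FreeProd.word w, FreeProd.word w')}

variable {a : ∀ k, Side → Module.End ℂ (ℂ × X k)} {a' : ∀ k, Side → Module.End ℂ (ℂ × X' k)}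
  {σ : K → K'}

theorem joinLeft_mem_shapeSpan {c : K → ℕ} {s : List (K × List Side)} {w : AltWord X}
    {w' : AltWord X'} (h : ShapePair a a' σ s w w') {k : K} (hw : AvoidLeft X k w)
    (hw' : AvoidLeft X' (σ k) w') (u : List Side)
    (hd : ∀ j, shapeDegree j ((k, u) :: s) ≤ c j)
    (hu : (orbit (a k) u).1 = (orbit (a' (σ k)) u).1) :
    (FreeProd.joinLeft (orbit (a k) u) w hw, FreeProd.joinLeft (orbit (a' (σ k)) u) w' hw') ∈
      shapeSpan a a' σ c := by
  have h1 : (FreeProd.word w, FreeProd.word w') ∈ shapeSpan a a' σ c := by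
    refine Submodule.subset_span ⟨s, w, w', h, fun j => le_trans ?_ (hd j), rfl⟩
    simp [shapeDegree]
  have h2 : (FreeProd.word (AltWord.cons (orbit (a k) u).2 w hw),
      FreeProd.word (AltWord.cons (orbit (a' (σ k)) u).2 w' hw')) ∈ shapeSpan a a' σ c := by
    refine Submodule.subset_span ⟨(k, u) :: s, _, _, ⟨?_, ?_⟩, hd, rfl⟩
    · simp [AltWord.cons, h.1]
    · simp [AltWord.cons, h.2]
  have h3 := Submodule.add_mem _ (Submodule.smul_mem _ (orbit (a k) u).1 h1) h2
  rw [Prod.smul_mk, Prod.mk_add_mk] at h3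
  rw [FreeProd.joinLeft, FreeProd.joinLeft, ← hu]
  exact h3

/-- Both operators transform tensors of equal shape by the same formula, whose coefficients are
marginal moments of order at most `c k + 1`. The bound grows only in the colour `k` that acts;
injectivity of `σ` ensures that a word not starting in colour `k` has a partner not starting in `σ
k`. -/
theorem leftRep_mem_shapeSpan [DecidableEq K] (hσ : Function.Injective σ) {c : K → ℕ} {k : K}
    (t : Side)
    (hm : ∀ u : List Side, u.length ≤ c k + 1 →
      (orbit (a k) u).1 = (orbit (a' (σ k)) u).1)
    {x : FreeProd X × FreeProd X'} (hx : x ∈ shapeSpan a a' σ c) :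
    (leftRep k (a k t) x.1, leftRep (σ k) (a' (σ k) t) x.2) ∈
      shapeSpan a a' σ (fun j => c j + if k = j then 1 else 0) := by
  suffices h : shapeSpan a a' σ c ≤
      (shapeSpan a a' σ (fun j => c j + if k = j then 1 else 0)).comap
        ((leftRep k (a k t)).prodMap (leftRep (σ k) (a' (σ k) t))) from h hx
  refine Submodule.span_le.2 ?_
  rintro v ⟨s, w, w', hs, hd, rfl⟩
  change (leftRep k (a k t) (FreeProd.word w), leftRep (σ k) (a' (σ k) t) (FreeProd.word w')) ∈
    shapeSpan a a' σ (fun j => c j + if k = j then 1 else 0)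
  have avoid_iff : ∀ (s : List (K × List Side)) (w : AltWord X) (w' : AltWord X'),
      ShapePair a a' σ s w w' → AvoidLeft X k w → AvoidLeft X' (σ k) w' := by
    intro s w w' hs hw
    cases s with
    | nil => simp [AvoidLeft, hs.2]
    | cons q s =>
      simp only [AvoidLeft, hs.1, List.map_cons, List.head?_cons, Option.mem_def] at hw
      simp only [AvoidLeft, hs.2, List.map_cons, List.head?_cons, Option.mem_def]
      rintro _ ⟨⟩
      exact fun e => hw _ rfl (hσ e)
  have single : ∀ j, shapeDegree j [(k, [t])] = if k = j then 1 else 0 := by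
    intro j
    simp only [shapeDegree, List.map_cons, List.map_nil, List.sum_cons, List.sum_nil,
      List.length_cons, List.length_nil]
    split_ifs <;> rfl
  have dcons : ∀ (j : K) (q : K × List Side) (s : List (K × List Side)),
      shapeDegree j (q :: s) = shapeDegree j [q] + shapeDegree j s := by
    intro j q s
    simp [shapeDegree]
  have key : AvoidLeft X k w ∨ ∃ u s', s = (k, u) :: s' := by
    cases s with
    | nil => left; simp [AvoidLeft, hs.1]
    | cons q s =>
      by_cases hq : k = q.1
      · right
        exact ⟨q.2, s, by rw [hq]⟩
      · left
        simp only [AvoidLeft, hs.1, List.map_cons, List.head?_cons, Option.mem_def]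
        rintro _ ⟨⟩
        exact hq
  -- Either a new letter labelled `[t]` is created, or the first letter, labelled `u`, is replaced
  -- by the vector of `t :: u` minus the moment of `u` times the vector of `[t]`.
  rcases key with hw | ⟨u, s', rfl⟩
  · have hw' := avoid_iff s w w' hs hw
    rw [leftRep_of_avoid k _ w hw, leftRep_of_avoid (σ k) _ w' hw']
    have := joinLeft_mem_shapeSpan (c := fun j => c j + if k = j then 1 else 0) hs hw hw' [t]
      (fun j => by rw [dcons, single, add_comm]; exact Nat.add_le_add_right (hd j) _)
      (hm _ (by simp))
    rwa [orbit_cons, orbit_cons, orbit_nil, orbit_nil] at this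
  · obtain ⟨w, hwc⟩ := w
    obtain ⟨w', hwc'⟩ := w'
    obtain ⟨h1, h2⟩ := hs
    simp only [List.map_cons] at h1 h2
    subst h1 h2
    let W : AltWord X := ⟨_, (List.isChain_cons.1 hwc).2⟩
    let W' : AltWord X' := ⟨_, (List.isChain_cons.1 hwc').2⟩
    have hs' : ShapePair a a' σ s' W W' := ⟨rfl, rfl⟩
    have hv : AvoidLeft X k W := (List.isChain_cons.1 hwc).1
    have hv' : AvoidLeft X' (σ k) W' := (List.isChain_cons.1 hwc').1
    have hul : u.length ≤ c k := by
      refine le_trans ?_ (hd k)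
      simp [shapeDegree]
    have m1 := joinLeft_mem_shapeSpan (c := fun j => c j + if k = j then 1 else 0) hs' hv hv'
      (t :: u)
      (fun j => by
        have := hd j
        have e : shapeDegree j [(k, t :: u)] = shapeDegree j [(k, u)] + if k = j then 1 else 0 := by
          simp only [shapeDegree, List.map_cons, List.map_nil, List.sum_cons, List.sum_nil,
            List.length_cons]
          split_ifs <;> rfl
        rw [dcons] at this ⊢
        rw [e]
        omega)
      (hm _ (by simpa using hul))
    have m2 := joinLeft_mem_shapeSpan (c := fun j => c j + if k = j then 1 else 0) hs' hv hv'
      [t] (fun j => by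
        have := hd j
        rw [dcons] at this ⊢
        rw [single]
        omega)
      (hm _ (by simp))
    have m3 := Submodule.sub_mem _ m1 (Submodule.smul_mem _ (orbit (a k) u).1 m2)
    have l1 := leftRep_cons k (a k t) (orbit (a k) u).2 W hv
    have l2 := leftRep_cons (σ k) (a' (σ k) t) (orbit (a' (σ k)) u).2 W' hv'
    rw [apply_orbit_snd, FreeProd.joinLeft_lin] at l1
    rw [apply_orbit_snd, FreeProd.joinLeft_lin, ← hm u (by omega)] at l2
    change (leftRep k (a k t) (FreeProd.word (AltWord.cons _ W hv)),
      leftRep (σ k) (a' (σ k) t) (FreeProd.word (AltWord.cons _ W' hv'))) ∈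
      shapeSpan a a' σ (fun j => c j + if k = j then 1 else 0)
    rw [l1, l2]
    convert m3 using 1
    simp [Prod.ext_iff]
    constructor <;> abel

theorem rev_mem_shapeSpan {c : K → ℕ} {x : FreeProd X × FreeProd X'}
    (hx : x ∈ shapeSpan a a' σ c) :
    (FreeProd.rev x.1, FreeProd.rev x.2) ∈ shapeSpan a a' σ c := by
  suffices h : shapeSpan a a' σ c ≤ (shapeSpan a a' σ c).comap
      (FreeProd.rev.prodMap FreeProd.rev) from h hx
  refine Submodule.span_le.2 ?_
  rintro v ⟨s, w, w', hs, hd, rfl⟩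
  change (FreeProd.rev (FreeProd.word w), FreeProd.rev (FreeProd.word w')) ∈ shapeSpan a a' σ c
  rw [FreeProd.rev_word, FreeProd.rev_word]
  refine Submodule.subset_span ⟨s.reverse, _, _, ⟨?_, ?_⟩, ?_, rfl⟩
  · simp [AltWord.reverse, hs.1]
  · simp [AltWord.reverse, hs.2]
  · intro k
    simpa [shapeDegree, List.sum_reverse] using hd k

theorem modelOp_mem_shapeSpan [DecidableEq K] (hσ : Function.Injective σ) {c : K → ℕ} {k : K}
    (t : Side)
    (hm : ∀ u : List Side, u.length ≤ c k + 1 →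
      (orbit (a k) u).1 = (orbit (a' (σ k)) u).1)
    {x : FreeProd X × FreeProd X'} (hx : x ∈ shapeSpan a a' σ c) :
    (modelOp a (k, t) x.1, modelOp a' (σ k, t) x.2) ∈
      shapeSpan a a' σ (fun j => c j + if k = j then 1 else 0) := by
  cases t
  · exact leftRep_mem_shapeSpan hσ _ hm hx
  · exact rev_mem_shapeSpan (leftRep_mem_shapeSpan hσ Side.right hm (rev_mem_shapeSpan hx))

/-- The mixed moments of a bi-free product are determined by the marginal moments, up to the number
of occurrences of each colour. -/
theorem modelMoment_congr [DecidableEq K] (hσ : Function.Injective σ) (w : List (K × Side))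
    (hm : ∀ k (u : List Side), u.length ≤ (w.map Prod.fst).count k →
      modelMoment a (u.map (Prod.mk k)) = modelMoment a' (u.map (Prod.mk (σ k)))) :
    modelMoment a w = modelMoment a' (w.map (Prod.map σ id)) := by
  -- Both vectors are followed simultaneously, as one element of the product space.
  have key : ∀ w : List (K × Side),
      (∀ k (u : List Side), u.length ≤ (w.map Prod.fst).count k →
        modelMoment a (u.map (Prod.mk k)) = modelMoment a' (u.map (Prod.mk (σ k)))) →
      ((w.map (modelOp a)).prod FreeProd.vacuum,
        ((w.map (Prod.map σ id)).map (modelOp a')).prod FreeProd.vacuum) ∈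
        shapeSpan a a' σ (fun k => (w.map Prod.fst).count k) := by
    intro w
    induction w with
    | nil =>
      intro _
      exact Submodule.subset_span ⟨[], AltWord.nil, AltWord.nil, ⟨rfl, rfl⟩,
        fun k => by simp [shapeDegree], rfl⟩
    | cons q w ih =>
      intro hm
      obtain ⟨k, t⟩ := q
      have h1 := ih fun j u hu => hm j u (hu.trans (by simp [List.count_cons]))
      have h2 := modelOp_mem_shapeSpan hσ t (fun u hu => by
        rw [← modelMoment_map_mk, ← modelMoment_map_mk]
        exact hm k u (by simpa [List.count_cons] using hu)) h1
      simpa [List.count_cons] using h2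
  -- Tensors of equal shape are both empty or both nonempty, so the two vacuum projections agree on
  -- the span.
  have hle : shapeSpan a a' σ (fun k => (w.map Prod.fst).count k) ≤
      LinearMap.ker (FreeProd.proj.coprod (-FreeProd.proj) :
        FreeProd X × FreeProd X' →ₗ[ℂ] ℂ) := by
    refine Submodule.span_le.2 ?_
    rintro v ⟨s, w, w', hs, hd, rfl⟩
    simp [FreeProd.proj_word, hs.1, hs.2]
  have h := hle (key w hm)
  simp only [LinearMap.mem_ker, LinearMap.coprod_apply, LinearMap.neg_apply] at h
  exact add_neg_eq_zero.1 h

end Universality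

/-! ### Moment functionals -/

section Moments

universe u v

/-- The moments of a family of elements of a non-commutative probability space. -/
def moment {A : Type*} [Ring A] [Algebra ℂ A] {I : Type*} (φ : A →ₗ[ℂ] ℂ) (Z : I → A)
    (w : List I) : ℂ :=
  φ (w.map Z).prod

/-- A moment functional is bi-free when it is the moment functional of operators on a free
product. -/
def IsBiFreeMoment.{w, x} {K : Type x} (m : List (K × Side) → ℂ) : Prop :=
  ∃ (X : K → Type w) (_ : ∀ k, AddCommGroup (X k)) (_ : ∀ k, Module ℂ (X k))
    (a : ∀ k, Side → Module.End ℂ (ℂ × X k)), ∀ w, m w = modelMoment a w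

theorem isBiFreeMoment_modelMoment {K : Type u} {X : K → Type v} [∀ k, AddCommGroup (X k)]
    [∀ k, Module ℂ (X k)] (a : ∀ k, Side → Module.End ℂ (ℂ × X k)) :
    IsBiFreeMoment.{v} (modelMoment a) :=
  ⟨X, _, _, a, fun _ => rfl⟩

variable {K K' : Type*} {m : List (K × Side) → ℂ} {m' : List (K' × Side) → ℂ}

theorem IsBiFreeMoment.congr [DecidableEq K] (h : IsBiFreeMoment.{u} m)
    (h' : IsBiFreeMoment.{v} m') {σ : K → K'} (hσ : Function.Injective σ) (w : List (K × Side))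
    (hm : ∀ k (u : List Side), u.length ≤ (w.map Prod.fst).count k →
      m (u.map (Prod.mk k)) = m' (u.map (Prod.mk (σ k)))) :
    m w = m' (w.map (Prod.map σ id)) := by
  obtain ⟨X, _, _, a, ha⟩ := h
  obtain ⟨X', _, _, a', ha'⟩ := h'
  simp only [ha, ha'] at hm ⊢
  exact modelMoment_congr hσ w hm

theorem IsBiFreeMoment.congr_id [DecidableEq K] {m' : List (K × Side) → ℂ}
    (h : IsBiFreeMoment.{u} m) (h' : IsBiFreeMoment.{v} m') (w : List (K × Side))
    (hm : ∀ k (u : List Side), u.length ≤ (w.map Prod.fst).count k →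
      m (u.map (Prod.mk k)) = m' (u.map (Prod.mk k))) :
    m w = m' w := by
  have := h.congr h' (σ := id) Function.injective_id w hm
  simpa using this

theorem IsBiFreeMoment.nil (h : IsBiFreeMoment.{u} m) : m [] = 1 := by
  obtain ⟨X, _, _, a, ha⟩ := h
  rw [ha, modelMoment, FreeProd.expect, List.map_nil, List.prod_nil, Module.End.one_apply,
    FreeProd.vacuum, FreeProd.proj_word]
  simp [AltWord.nil]

/-- A moment in which some centred colour occurs exactly once vanishes. -/
theorem IsBiFreeMoment.eq_zero [DecidableEq K] (h : IsBiFreeMoment.{u} m) {w : List (K × Side)}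
    {k : K} (hk : (w.map Prod.fst).count k = 1) (h0 : ∀ t, m [(k, t)] = 0) : m w = 0 := by
  obtain ⟨X, _, _, a, ha⟩ := h
  -- Replacing the operators of colour `k` by zero leaves its moments of order at most one
  -- unchanged. By comparison `m w` does not change either, but the new product contains a zero
  -- factor.
  let a' : ∀ j, Side → Module.End ℂ (ℂ × X j) := fun j => if j = k then 0 else a j
  have hz : ∀ t, modelOp a' (k, t) = 0 := by
    intro t
    cases t
    · simp only [modelOp, a', if_true, ← leftRepHom_apply, Pi.zero_apply, map_zero]
    · simp only [modelOp, a', if_true, ← rightRepHom_apply, Pi.zero_apply, map_zero]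
  have hzero : ∀ (w : List (K × Side)) t, (k, t) ∈ w → modelMoment a' w = 0 := by
    intro w t ht
    have : (w.map (modelOp a')).prod = 0 := by
      refine List.prod_eq_zero ?_
      rw [← hz t]
      exact List.mem_map_of_mem ht
    rw [modelMoment, this, FreeProd.expect, LinearMap.zero_apply, map_zero]
  have hw : m w = modelMoment a' w := by
    refine IsBiFreeMoment.congr_id ⟨X, _, _, a, ha⟩ (isBiFreeMoment_modelMoment a') w ?_
    intro j u hu
    by_cases hj : j = k
    · subst hj
      rw [hk] at hu
      match u, hu with
      | [], _ =>
        rw [List.map_nil, IsBiFreeMoment.nil ⟨X, _, _, a, ha⟩,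
          (isBiFreeMoment_modelMoment a').nil]
      | [t], _ =>
        rw [List.map_cons, List.map_nil, h0, hzero _ t (by simp)]
    · rw [ha, modelMoment_map_mk, modelMoment_map_mk]
      simp only [a', if_neg hj]
  rw [hw]
  have hmem : k ∈ w.map Prod.fst := List.count_pos_iff.1 (by omega)
  obtain ⟨q, hq, rfl⟩ := List.mem_map.1 hmem
  exact hzero w q.2 hq

end Moments

/-! ### Moments of words and functionals on the free algebra -/

section FreeAlgebraWords

variable {I J : Type*}

theorem freeAlgebra_hom_ext_words {M : Type*} [AddCommGroup M] [Module ℂ M]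
    {f g : FreeAlgebra ℂ I →ₗ[ℂ] M}
    (h : ∀ w : List I, f (w.map (FreeAlgebra.ι ℂ)).prod = g (w.map (FreeAlgebra.ι ℂ)).prod) :
    f = g := by
  have htop : Submodule.span ℂ
      (Submonoid.closure (Set.range (FreeAlgebra.ι ℂ : I → FreeAlgebra ℂ I)) :
        Set (FreeAlgebra ℂ I)) = ⊤ := by
    rw [← Algebra.adjoin_eq_span, FreeAlgebra.adjoin_range_ι]
    rfl
  refine LinearMap.ext_on htop ?_
  intro x hx
  obtain ⟨l, hl, rfl⟩ := Submonoid.exists_list_of_mem_closure hx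
  obtain ⟨w, rfl⟩ : ∃ w : List I, w.map (FreeAlgebra.ι ℂ) = l := by
    have : l ∈ Set.range (List.map (FreeAlgebra.ι ℂ : I → FreeAlgebra ℂ I)) := by
      rw [Set.range_list_map]
      exact hl
    exact this
  exact h w

variable {A B : Type*} [Ring A] [Algebra ℂ A] [Ring B] [Algebra ℂ B]

theorem lift_prod_ι (Z : I → A) (w : List I) :
    FreeAlgebra.lift ℂ Z (w.map (FreeAlgebra.ι ℂ)).prod = (w.map Z).prod := by
  rw [map_list_prod, List.map_map]
  congr 2
  funext i
  simp

theorem comp_lift_eq {φ : A →ₗ[ℂ] ℂ} {ψ : B →ₗ[ℂ] ℂ} {Z : I → A} {Y : I → B}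
    (h : ∀ w, moment φ Z w = moment ψ Y w) (P : FreeAlgebra ℂ I) :
    φ (FreeAlgebra.lift ℂ Z P) = ψ (FreeAlgebra.lift ℂ Y P) := by
  have : φ ∘ₗ (FreeAlgebra.lift ℂ Z).toLinearMap = ψ ∘ₗ (FreeAlgebra.lift ℂ Y).toLinearMap := by
    refine freeAlgebra_hom_ext_words fun w => ?_
    simp only [LinearMap.comp_apply, AlgHom.toLinearMap_apply, lift_prod_ι]
    exact h w
  exact LinearMap.congr_fun this P

/-- Equality of moments passes to families of polynomials in the variables. -/
theorem moment_lift_eq {φ : A →ₗ[ℂ] ℂ} {ψ : B →ₗ[ℂ] ℂ} {Z : I → A} {Y : I → B}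
    (h : ∀ w, moment φ Z w = moment ψ Y w) (q : J → FreeAlgebra ℂ I) (w : List J) :
    moment φ (fun j => FreeAlgebra.lift ℂ Z (q j)) w =
      moment ψ (fun j => FreeAlgebra.lift ℂ Y (q j)) w := by
  have := comp_lift_eq h (w.map q).prod
  rw [map_list_prod (FreeAlgebra.lift ℂ Z), map_list_prod (FreeAlgebra.lift ℂ Y),
    List.map_map, List.map_map] at this
  exact this

end FreeAlgebraWords

/-! ### The standard model of a bi-free family -/

section StandardModel

universe u v

variable {A : Type u} [Ring A] [Algebra ℂ A] {φ : A →ₗ[ℂ] ℂ}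

/-- The decomposition of `A` as the sum of `ℂ` and of the kernel of the state. -/
noncomputable def stateEquiv (hφ : φ 1 = 1) : A ≃ₗ[ℂ] ℂ × LinearMap.ker φ where
  toFun x := (φ x, ⟨x - φ x • 1, by simp [hφ]⟩)
  invFun z := z.1 • 1 + z.2
  map_add' x y := by
    ext
    · simp
    · simp [add_smul]; abel
  map_smul' c x := by
    ext
    · simp
    · simp [smul_sub, mul_smul]
  left_inv x := by simp
  right_inv z := by
    obtain ⟨c, y, hy⟩ := z
    have hy' : φ y = 0 := hy
    ext <;> simp [hφ, hy']

/-- Left multiplication, as a representation on `ℂ ⊕ ker φ`. -/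
noncomputable def standardRep (hφ : φ 1 = 1) : A →ₐ[ℂ] Module.End ℂ (ℂ × LinearMap.ker φ) :=
  ((stateEquiv hφ).conjAlgEquiv ℂ).toAlgHom.comp (Algebra.lmul ℂ A)

theorem standardRep_apply_one (hφ : φ 1 = 1) (x : A) :
    standardRep hφ x (1, 0) = stateEquiv hφ x := by
  have : (stateEquiv hφ).symm (1, 0) = 1 := by
    change (1 : ℂ) • (1 : A) + ((0 : LinearMap.ker φ) : A) = 1
    simp
  simp [standardRep, LinearEquiv.conjAlgEquiv_apply, this]

theorem orbit_standardRep (hφ : φ 1 = 1) (Z : Side → A) (u : List Side) :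
    (orbit (fun t => standardRep hφ (Z t)) u).1 = moment φ Z u := by
  have : (u.map fun t => standardRep hφ (Z t)).prod = standardRep hφ (u.map Z).prod := by
    rw [map_list_prod, List.map_map]
    rfl
  rw [orbit, this, standardRep_apply_one]
  rfl

variable {K : Type*}

/-- The variable of colour `k` and side `t`. -/
def facePair (T S : K → A) (q : K × Side) : A :=
  twoFaced (T q.1) (S q.1) q.2

theorem moment_facePair_map_mk (T S : K → A) (k : K) (u : List Side) :
    moment φ (facePair T S) (u.map (Prod.mk k)) = moment φ (twoFaced (T k) (S k)) u := by
  rw [moment, List.map_map]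
  rfl

theorem jointDistribution_words (T S : A) (u : List Side) :
    jointDistribution φ T S (u.map (FreeAlgebra.ι ℂ)).prod = moment φ (twoFaced T S) u := by
  simp only [jointDistribution, LinearMap.comp_apply, AlgHom.toLinearMap_apply, lift_prod_ι]
  rfl

theorem IsBiFreeFamily.isBiFreeMoment {T S : K → A} (h : IsBiFreeFamily φ T S) :
    IsBiFreeMoment.{u} (moment φ (facePair T S)) := by
  obtain ⟨X, _, _, l, r, h⟩ := h
  let a : ∀ k, Side → Module.End ℂ (ℂ × X k) := fun k =>
    fun | Side.left => l k ⟨T k, Algebra.self_mem_adjoin_singleton ℂ (T k)⟩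
        | Side.right => r k ⟨S k, Algebra.self_mem_adjoin_singleton ℂ (S k)⟩
  let g : K × Side → (Σ k, (Algebra.adjoin ℂ {T k}) ⊕ (Algebra.adjoin ℂ {S k})) :=
    fun | (k, Side.left) => ⟨k, Sum.inl ⟨T k, Algebra.self_mem_adjoin_singleton ℂ (T k)⟩⟩
        | (k, Side.right) => ⟨k, Sum.inr ⟨S k, Algebra.self_mem_adjoin_singleton ℂ (S k)⟩⟩
  refine ⟨X, _, _, a, fun w => ?_⟩
  have hw := h (w.map g)
  rw [List.map_map, List.map_map] at hw
  have h₁ : faceElement ∘ g = facePair T S := by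
    funext ⟨k, t⟩
    cases t <;> rfl
  have h₂ : faceOperator l r ∘ g = modelOp a := by
    funext ⟨k, t⟩
    cases t <;> rfl
  rw [h₁, h₂] at hw
  exact hw

/-- Bi-freeness depends on the moments alone. The given spaces are exchanged for `A ≅ ℂ ⊕ ker φ`
with left multiplication for both faces; this model has the right marginals, hence by comparison the
right mixed moments. It also lives in the universe required by `IsBiFree`. -/
theorem isBiFreeFamily_of_isBiFreeMoment (hφ : φ 1 = 1) {T S : K → A}
    (h : IsBiFreeMoment.{v} (moment φ (facePair T S))) : IsBiFreeFamily φ T S := by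
  classical
  let L := standardRep hφ
  let a : ∀ _ : K, Side → Module.End ℂ (ℂ × LinearMap.ker φ) :=
    fun k t => L (facePair T S (k, t))
  have hm : ∀ w, moment φ (facePair T S) w =
      moment (FreeProd.proj ∘ₗ LinearMap.applyₗ FreeProd.vacuum) (modelOp a) w := by
    intro w
    refine h.congr_id (isBiFreeMoment_modelMoment a) w fun k u _ => ?_
    rw [modelMoment_map_mk, orbit_standardRep, moment, moment, List.map_map]
    rfl
  refine ⟨fun _ => LinearMap.ker φ, inferInstance, inferInstance,
    fun k => L.comp (Subalgebra.val _), fun k => L.comp (Subalgebra.val _), fun w => ?_⟩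
  -- Passage from generators to whole faces: an element of a face is a polynomial in its generator,
  -- and its operator is the same polynomial in the operator of the generator.
  have lift_ex : ∀ x : (Σ k, (Algebra.adjoin ℂ {T k}) ⊕ (Algebra.adjoin ℂ {S k})),
      ∃ P : FreeAlgebra ℂ (K × Side),
        FreeAlgebra.lift ℂ (facePair T S) P = faceElement x ∧
        FreeAlgebra.lift ℂ (modelOp a) P =
          faceOperator (X := fun _ => LinearMap.ker φ) (fun k => L.comp (Subalgebra.val _))
            (fun k => L.comp (Subalgebra.val _)) x := by
    rintro ⟨k, ⟨c, hc⟩ | ⟨c, hc⟩⟩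
    · rw [Algebra.adjoin_singleton_eq_range_aeval] at hc
      obtain ⟨p, rfl⟩ := hc
      refine ⟨Polynomial.aeval (FreeAlgebra.ι ℂ (k, Side.left)) p, ?_, ?_⟩
      · rw [← Polynomial.aeval_algHom_apply, FreeAlgebra.lift_ι_apply]
        rfl
      · rw [← Polynomial.aeval_algHom_apply, FreeAlgebra.lift_ι_apply]
        change Polynomial.aeval (leftRepHom (X := fun _ => LinearMap.ker φ) k (L (T k))) p =
          leftRepHom (X := fun _ => LinearMap.ker φ) k (L (Polynomial.aeval (T k) p))
        rw [Polynomial.aeval_algHom_apply, Polynomial.aeval_algHom_apply]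
    · rw [Algebra.adjoin_singleton_eq_range_aeval] at hc
      obtain ⟨p, rfl⟩ := hc
      refine ⟨Polynomial.aeval (FreeAlgebra.ι ℂ (k, Side.right)) p, ?_, ?_⟩
      · rw [← Polynomial.aeval_algHom_apply, FreeAlgebra.lift_ι_apply]
        rfl
      · rw [← Polynomial.aeval_algHom_apply, FreeAlgebra.lift_ι_apply]
        change Polynomial.aeval (rightRepHom (X := fun _ => LinearMap.ker φ) k (L (S k))) p =
          rightRepHom (X := fun _ => LinearMap.ker φ) k (L (Polynomial.aeval (S k) p))
        rw [Polynomial.aeval_algHom_apply, Polynomial.aeval_algHom_apply]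
  choose P hP₁ hP₂ using lift_ex
  have := moment_lift_eq hm P w
  simp only [hP₁, hP₂] at this
  exact this

end StandardModel

/-! ### The algebraic full Fock space

The full Fock space over the free vector space on `I` is the free algebra on `I`, the vacuum being
the unit and the vacuum state the augmentation. -/

section Fock

variable {I J L : Type*}

/-- The vacuum state of the Fock space. -/
noncomputable def aug : FreeAlgebra ℂ I →ₐ[ℂ] ℂ := FreeAlgebra.lift ℂ fun _ => 0

@[simp] theorem aug_ι (i : I) : aug (FreeAlgebra.ι ℂ i) = 0 := by
  simp [aug]

/-- The triangular representation whose corner entry is the left annihilation operator. -/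
noncomputable def foxRep (g : I → ℂ) :
    FreeAlgebra ℂ I →ₐ[ℂ] Module.End ℂ (FreeAlgebra ℂ I × FreeAlgebra ℂ I) :=
  FreeAlgebra.lift ℂ fun i =>
    ((LinearMap.mulLeft ℂ (FreeAlgebra.ι ℂ i)).comp (LinearMap.fst ℂ _ _)).prod
      (g i • LinearMap.fst ℂ _ _)

/-- Left annihilation by the linear functional `g`. -/
noncomputable def annih (g : I → ℂ) : Module.End ℂ (FreeAlgebra ℂ I) :=
  LinearMap.snd ℂ _ _ ∘ₗ LinearMap.applyₗ (1, 0) ∘ₗ (foxRep g).toLinearMap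

theorem annih_def (g : I → ℂ) (x : FreeAlgebra ℂ I) : annih g x = (foxRep g x (1, 0)).2 := rfl

/-- As a matrix, `foxRep g x` is lower triangular with diagonal `x`, `aug x` and corner `annih g x`.
Multiplicativity thus becomes the Leibniz rule of a Fox derivative, `annih_mul`. -/
theorem foxRep_apply (g : I → ℂ) (x : FreeAlgebra ℂ I) :
    ∀ u v, foxRep g x (u, v) = (x * u, annih g x * u + aug x • v) := by
  induction x using FreeAlgebra.induction with
  | grade0 r =>
    intro u v
    simp [annih_def, Algebra.smul_def]
  | grade1 i =>
    intro u v
    simp [annih_def, foxRep]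
  | mul x y hx hy =>
    intro u v
    have h : annih g (x * y) = annih g x * y + aug x • annih g y := by
      rw [annih_def, map_mul, Module.End.mul_apply, hy, hx]
      simp
    rw [map_mul, Module.End.mul_apply, hy, hx, h, map_mul, mul_assoc, smul_add, add_mul, mul_smul,
      mul_assoc, smul_mul_assoc, add_assoc]
  | add x y hx hy =>
    intro u v
    simp only [map_add, LinearMap.add_apply, hx, hy, Prod.mk_add_mk, add_mul, add_smul]
    congr 1
    abel

@[simp] theorem annih_one (g : I → ℂ) : annih g 1 = 0 := by
  simp [annih_def]

@[simp] theorem annih_ι (g : I → ℂ) (i : I) : annih g (FreeAlgebra.ι ℂ i) = g i • 1 := by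
  simp [annih_def, foxRep]

theorem annih_mul (g : I → ℂ) (x y : FreeAlgebra ℂ I) :
    annih g (x * y) = annih g x * y + aug x • annih g y := by
  rw [annih_def, map_mul, Module.End.mul_apply, foxRep_apply g y, foxRep_apply]
  simp

@[simp] theorem annih_algebraMap (g : I → ℂ) (r : ℂ) :
    annih g (algebraMap ℂ (FreeAlgebra ℂ I) r) = 0 := by
  rw [Algebra.algebraMap_eq_smul_one, map_smul, annih_one, smul_zero]

theorem annih_zero : annih (0 : I → ℂ) = 0 := by
  ext x
  induction x using FreeAlgebra.induction with
  | grade0 r => simp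
  | grade1 i => simp
  | mul x y hx hy => simp only [annih_mul, hx, hy]; simp
  | add x y hx hy => rw [map_add, hx, hy, map_add]

/-- The reversal of tensors. -/
noncomputable def mirror : FreeAlgebra ℂ I →ₗ[ℂ] FreeAlgebra ℂ I :=
  (MulOpposite.opLinearEquiv ℂ).symm.toLinearMap ∘ₗ
    (FreeAlgebra.starHom (R := ℂ) (X := I)).toLinearMap

@[simp] theorem mirror_mirror (x : FreeAlgebra ℂ I) : mirror (mirror x) = x := star_star x

theorem mirror_mul (x y : FreeAlgebra ℂ I) : mirror (x * y) = mirror y * mirror x := star_mul x y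

@[simp] theorem mirror_one : mirror (1 : FreeAlgebra ℂ I) = 1 := star_one _

@[simp] theorem mirror_ι (i : I) : mirror (FreeAlgebra.ι ℂ i) = FreeAlgebra.ι ℂ i :=
  FreeAlgebra.star_ι i

@[simp] theorem aug_mirror (x : FreeAlgebra ℂ I) : aug (mirror x) = aug x := by
  induction x using FreeAlgebra.induction with
  | grade0 r => rw [Algebra.algebraMap_eq_smul_one, map_smul, mirror_one]
  | grade1 i => simp
  | mul x y hx hy => rw [mirror_mul, map_mul, map_mul, hx, hy, mul_comm]
  | add x y hx hy => rw [map_add, map_add, map_add, hx, hy]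

/-- The sum of the left creation operator of `i` and of the left annihilation operator of `g`. -/
noncomputable def leftField (g : I → ℂ) (i : I) : Module.End ℂ (FreeAlgebra ℂ I) :=
  LinearMap.mulLeft ℂ (FreeAlgebra.ι ℂ i) + annih g

theorem leftField_apply (g : I → ℂ) (i : I) (x : FreeAlgebra ℂ I) :
    leftField g i x = FreeAlgebra.ι ℂ i * x + annih g x := rfl

/-- The field acts on the first factor alone when that factor has no vacuum component or when the
second factor is annihilated. The second alternative gives bi-freeness in `concat_leftRep`. -/
theorem leftField_mul (g : I → ℂ) (i : I) (x y : FreeAlgebra ℂ I) :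
    leftField g i (x * y) = leftField g i x * y + aug x • annih g y := by
  rw [leftField_apply, leftField_apply, annih_mul, add_mul, mul_assoc, add_assoc]

/-- The field operators on the Fock space with covariance `C`, acting from the left or from the
right according to `s`. -/
noncomputable def field (C : I → I → ℂ) (s : I → Side) (i : I) : Module.End ℂ (FreeAlgebra ℂ I) :=
  match s i with
  | Side.left => leftField (C i) i
  | Side.right => mirror ∘ₗ leftField (C i) i ∘ₗ mirror

/-- The vacuum expectation on the operators on the Fock space. -/
noncomputable def fockState : Module.End ℂ (FreeAlgebra ℂ I) →ₗ[ℂ] ℂ :=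
  aug.toLinearMap ∘ₗ LinearMap.applyₗ 1

theorem fockState_apply (Z : Module.End ℂ (FreeAlgebra ℂ I)) : fockState Z = aug (Z 1) := rfl

/-- The vacuum moments of the field operators. -/
noncomputable def fockMoment (C : I → I → ℂ) (s : I → Side) (w : List I) : ℂ :=
  moment fockState (field C s) w

variable (T : Finset L) (e : J → L → I) (m : J → L → ℂ)

/-- The second quantization of the linear map sending `j` to `∑ l, m j l • e j l`. -/
noncomputable def secondQuant : FreeAlgebra ℂ J →ₐ[ℂ] FreeAlgebra ℂ I :=
  FreeAlgebra.lift ℂ fun j => ∑ l ∈ T, m j l • FreeAlgebra.ι ℂ (e j l)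

@[simp] theorem secondQuant_ι (j : J) :
    secondQuant T e m (FreeAlgebra.ι ℂ j) = ∑ l ∈ T, m j l • FreeAlgebra.ι ℂ (e j l) := by
  simp [secondQuant]

@[simp] theorem aug_secondQuant (x : FreeAlgebra ℂ J) : aug (secondQuant T e m x) = aug x := by
  have : (aug.comp (secondQuant T e m)) = aug := by
    ext j
    simp
  exact DFunLike.congr_fun this x

theorem secondQuant_mirror (x : FreeAlgebra ℂ J) :
    mirror (secondQuant T e m x) = secondQuant T e m (mirror x) := by
  induction x using FreeAlgebra.induction with
  | grade0 r => simp only [Algebra.algebraMap_eq_smul_one, map_smul, mirror_one, map_one]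
  | grade1 i => simp
  | mul x y hx hy => rw [mirror_mul, map_mul, mirror_mul, map_mul, hx, hy]
  | add x y hx hy => simp only [map_add, hx, hy]

/-- Second quantization intertwines annihilation by a functional with annihilation by its pullback.
The outer sum over `U` allows linear combinations of annihilators, as required for sums of fields.
-/
theorem sum_annih_secondQuant {M : Type*} (U : Finset M) (c : M → ℂ) (g : M → I → ℂ) (h : J → ℂ)
    (hh : ∀ j, h j = ∑ a ∈ U, ∑ l ∈ T, c a * m j l * g a (e j l)) (x : FreeAlgebra ℂ J) :
    ∑ a ∈ U, c a • annih (g a) (secondQuant T e m x) = secondQuant T e m (annih h x) := by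
  induction x using FreeAlgebra.induction with
  | grade0 r => simp
  | grade1 j =>
    simp only [secondQuant_ι, map_sum, map_smul, annih_ι, map_one, hh, Finset.sum_smul,
      Finset.smul_sum, smul_smul, mul_assoc]
  | mul x y hx hy =>
    simp only [annih_mul, map_mul, map_add, map_smul, smul_add, Finset.sum_add_distrib,
      aug_secondQuant, ← hx, ← hy, Finset.sum_mul, Finset.smul_sum, smul_mul_assoc]
    congr 1
    exact Finset.sum_congr rfl fun a _ => smul_comm _ _ _
  | add x y hx hy => simp only [map_add, smul_add, Finset.sum_add_distrib, hx, hy]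

variable {T e m} {C : I → I → ℂ} {s : I → Side} {C' : J → J → ℂ} {s' : J → Side}

theorem secondQuant_leftField
    (hC : ∀ j j', C' j j' = ∑ l ∈ T, ∑ l' ∈ T, m j l * m j' l' * C (e j l) (e j' l')) (j : J)
    (x : FreeAlgebra ℂ J) :
    secondQuant T e m (leftField (C' j) j x) =
      ∑ l ∈ T, m j l • leftField (C (e j l)) (e j l) (secondQuant T e m x) := by
  rw [leftField_apply, map_add, map_mul, secondQuant_ι, ← sum_annih_secondQuant T e m T (m j)
    (fun l => C (e j l)) (C' j) (fun j' => hC j j'), Finset.sum_mul, ← Finset.sum_add_distrib]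
  refine Finset.sum_congr rfl fun l _ => ?_
  rw [leftField_apply, smul_add, smul_mul_assoc]

theorem secondQuant_field (hs : ∀ j, ∀ l ∈ T, s (e j l) = s' j)
    (hC : ∀ j j', C' j j' = ∑ l ∈ T, ∑ l' ∈ T, m j l * m j' l' * C (e j l) (e j' l')) (j : J)
    (x : FreeAlgebra ℂ J) :
    secondQuant T e m (field C' s' j x) =
      (∑ l ∈ T, m j l • field C s (e j l)) (secondQuant T e m x) := by
  rw [LinearMap.sum_apply]
  cases h : s' j with
  | left =>
    simp only [field, h]
    rw [secondQuant_leftField hC]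
    refine Finset.sum_congr rfl fun l hl => ?_
    rw [hs j l hl, h]
    rfl
  | right =>
    simp only [field, h, LinearMap.comp_apply]
    rw [← secondQuant_mirror, secondQuant_leftField hC, map_sum]
    refine Finset.sum_congr rfl fun l hl => ?_
    rw [hs j l hl, h, map_smul, ← secondQuant_mirror]
    rfl

/-- Linear combinations of field operators are field operators. -/
theorem fockMoment_eq_sum (hs : ∀ j, ∀ l ∈ T, s (e j l) = s' j)
    (hC : ∀ j j', C' j j' = ∑ l ∈ T, ∑ l' ∈ T, m j l * m j' l' * C (e j l) (e j' l'))
    (w : List J) :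
    fockMoment C' s' w =
      moment fockState (fun j => ∑ l ∈ T, m j l • field C s (e j l)) w := by
  -- Second quantization intertwines the fields, fixes the vacuum and preserves the vacuum state, so
  -- it preserves vacuum moments.
  have key : ∀ w : List J, secondQuant T e m ((w.map (field C' s')).prod 1) =
      (w.map fun j => ∑ l ∈ T, m j l • field C s (e j l)).prod 1 := by
    intro w
    induction w with
    | nil => simp
    | cons j w ih =>
      rw [List.map_cons, List.map_cons, List.prod_cons, List.prod_cons, Module.End.mul_apply,
        Module.End.mul_apply, secondQuant_field hs hC, ih]
  rw [fockMoment, moment, moment, fockState_apply, fockState_apply, ← key, aug_secondQuant]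

end Fock

/-! ### Fock spaces as free products -/

section FockFreeProduct

universe u

variable {K : Type u}

open Classical in
/-- The covariance of a family of uncorrelated pairs with the same covariance. -/
noncomputable def blockCov (c : Side → Side → ℂ) (p q : K × Side) : ℂ :=
  if p.1 = q.1 then c p.2 q.2 else 0

/-- The moments of the bi-free Gaussian pair with covariance `c`. -/
noncomputable def gaussMoment (c : Side → Side → ℂ) (u : List Side) : ℂ :=
  fockMoment c id u

/-- The inclusion of the Fock space of one colour. -/
noncomputable def colourIncl (k : K) : FreeAlgebra ℂ Side →ₐ[ℂ] FreeAlgebra ℂ (K × Side) :=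
  secondQuant {()} (fun t _ => (k, t)) (fun _ _ => 1)

theorem colourIncl_leftField (c : Side → Side → ℂ) (k : K) (t : Side) (x : FreeAlgebra ℂ Side) :
    colourIncl k (leftField (c t) t x) =
      leftField (blockCov c (k, t)) (k, t) (colourIncl k x) := by
  have := secondQuant_leftField (T := {()}) (e := fun t _ => (k, t)) (m := fun _ _ => 1)
    (C := blockCov c) (C' := c) (fun j j' => by simp [blockCov]) t x
  simpa [colourIncl] using this

theorem fockMoment_blockCov_map_mk (c : Side → Side → ℂ) (k : K) (u : List Side) :
    fockMoment (blockCov c) Prod.snd (u.map (Prod.mk k)) = gaussMoment c u := by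
  have h := fockMoment_eq_sum (T := {()}) (e := fun t _ => (k, t)) (m := fun _ _ => 1)
    (C := blockCov c) (s := Prod.snd) (C' := c) (s' := id) (fun j l _ => rfl)
    (fun j j' => by simp [blockCov]) u
  rw [gaussMoment, h, fockMoment, moment, moment, List.map_map]
  congr 3
  funext t
  simp

theorem annih_colourIncl (c : Side → Side → ℂ) {k j : K} (hkj : k ≠ j) (t : Side)
    (x : FreeAlgebra ℂ Side) : annih (blockCov c (k, t)) (colourIncl j x) = 0 := by
  have := sum_annih_secondQuant {()} (fun t _ => (j, t)) (fun _ _ => 1) {()} (fun _ => 1)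
    (fun _ => blockCov c (k, t)) (0 : Side → ℂ) (fun i => by simp [blockCov, hkj]) x
  simpa [annih_zero, colourIncl] using this

/-- The identification of `ℂ ⊕ F` with `F`, up to a redundant summand: `(c, x)` is sent to
`c + (x - aug x)`. -/
noncomputable def unital : ℂ × FreeAlgebra ℂ Side →ₗ[ℂ] FreeAlgebra ℂ Side :=
  (LinearMap.toSpanSingleton ℂ (FreeAlgebra ℂ Side) 1).coprod
    (LinearMap.id - LinearMap.toSpanSingleton ℂ _ 1 ∘ₗ aug.toLinearMap)

theorem unital_apply (z : ℂ × FreeAlgebra ℂ Side) : unital z = z.1 • 1 + (z.2 - aug z.2 • 1) := by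
  simp [unital]

/-- The Gaussian pair of operators on `ℂ ⊕ F`. -/
noncomputable def gaussOp (c : Side → Side → ℂ) (t : Side) :
    Module.End ℂ (ℂ × FreeAlgebra ℂ Side) :=
  (aug.toLinearMap.prod LinearMap.id) ∘ₗ field c id t ∘ₗ unital

/-- The map `x ↦ (aug x, x)` is a section of `unital`. The redundant summand therefore does no harm,
and `unital` intertwines the two actions. -/
theorem unital_gaussOp (c : Side → Side → ℂ) (t : Side) (z : ℂ × FreeAlgebra ℂ Side) :
    unital (gaussOp c t z) = field c id t (unital z) := by
  rw [unital_apply]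
  simp [gaussOp]

variable (r : FreeAlgebra ℂ Side →ₗ[ℂ] FreeAlgebra ℂ Side)

/-- A letter of a free product, as a vector of the Fock space. -/
noncomputable def fockLetter (q : Σ _ : K, FreeAlgebra ℂ Side) : FreeAlgebra ℂ (K × Side) :=
  colourIncl q.1 (r (unital (0, q.2)))

/-- Concatenation, from a free product of Fock spaces to a Fock space. -/
noncomputable def concat :
    FreeProd (fun _ : K => FreeAlgebra ℂ Side) →ₗ[ℂ] FreeAlgebra ℂ (K × Side) :=
  FreeProd.lift (fun w => (w.1.map (fockLetter r)).prod) (by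
    intro p q k x y c w w₁ w₂ h h₁ h₂
    have : fockLetter r ⟨k, c • x + y⟩ = c • fockLetter r ⟨k, x⟩ + fockLetter r ⟨k, y⟩ := by
      simp only [fockLetter, ← map_smul, ← map_add]
      simp
    simp only [h, h₁, h₂, List.map_append, List.map_cons, List.prod_append, List.prod_cons, this,
      add_mul, mul_add, smul_mul_assoc, mul_smul_comm])

theorem concat_word (w : AltWord fun _ : K => FreeAlgebra ℂ Side) :
    concat r (FreeProd.word w) = (w.1.map (fockLetter r)).prod := by
  rw [concat, FreeProd.lift_word]

variable {r}

theorem concat_joinLeft (h1 : r 1 = 1) {k : K} (z : ℂ × FreeAlgebra ℂ Side)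
    (w : AltWord fun _ : K => FreeAlgebra ℂ Side) (hw : AvoidLeft _ k w) :
    concat r (FreeProd.joinLeft z w hw) =
      colourIncl k (r (unital z)) * concat r (FreeProd.word w) := by
  have hz : unital z = z.1 • 1 + unital (0, z.2) := by simp [unital_apply]
  rw [FreeProd.joinLeft, map_add, map_smul, concat_word r (AltWord.cons z.2 w hw), hz, map_add,
    map_add, map_smul, map_smul, h1, map_one, add_mul, smul_one_mul, concat_word]
  rfl

theorem aug_fockLetter (ha : ∀ x, aug (r x) = aug x) (q : Σ _ : K, FreeAlgebra ℂ Side) :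
    aug (fockLetter r q) = 0 := by
  simp [fockLetter, colourIncl, ha, unital_apply]

/-- Letters are centred before concatenation, so only the empty word contributes to the vacuum
component. -/
theorem aug_concat (ha : ∀ x, aug (r x) = aug x)
    (v : FreeProd (fun _ : K => FreeAlgebra ℂ Side)) : aug (concat r v) = FreeProd.proj v := by
  have : aug.toLinearMap ∘ₗ concat r =
      (FreeProd.proj : FreeProd (fun _ : K => FreeAlgebra ℂ Side) →ₗ[ℂ] ℂ) := by
    refine FreeProd.ext_word fun w => ?_
    rw [LinearMap.comp_apply, AlgHom.toLinearMap_apply, concat_word, FreeProd.proj_word]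
    cases hw : w.1 with
    | nil => simp
    | cons q l => simp [aug_fockLetter ha]
  exact LinearMap.congr_fun this v

theorem annih_concat (ha : ∀ x, aug (r x) = aug x) (c : Side → Side → ℂ) (k : K) (t : Side)
    (w : AltWord fun _ : K => FreeAlgebra ℂ Side) (hw : AvoidLeft _ k w) :
    annih (blockCov c (k, t)) (concat r (FreeProd.word w)) = 0 := by
  rw [concat_word]
  cases h : w.1 with
  | nil => simp
  | cons q l =>
    have hq : k ≠ q.1 := hw q (by simp [h])
    rw [List.map_cons, List.prod_cons, annih_mul, aug_fockLetter ha, zero_smul, add_zero,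
      fockLetter, annih_colourIncl c hq, zero_mul]

/-- If `w` does not start in colour `k`, the annihilator of colour `k` kills its concatenation,
because covariances between different colours vanish. By `leftField_mul` the field then acts only on
the leading factor, exactly as `leftRep` does. -/
theorem concat_leftRep (h1 : r 1 = 1) (ha : ∀ x, aug (r x) = aug x) (c : Side → Side → ℂ) (k : K)
    (t : Side) (A : Module.End ℂ (ℂ × FreeAlgebra ℂ Side))
    (hA : ∀ z, r (unital (A z)) = leftField (c t) t (r (unital z)))
    (v : FreeProd (fun _ : K => FreeAlgebra ℂ Side)) :
    concat r (leftRep k A v) = leftField (blockCov c (k, t)) (k, t) (concat r v) := by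
  have : concat r ∘ₗ leftRep k A = leftField (blockCov c (k, t)) (k, t) ∘ₗ concat r := by
    refine FreeProd.ext_joinLeft k fun z w hw => ?_
    rw [LinearMap.comp_apply, LinearMap.comp_apply, leftRep_joinLeft, concat_joinLeft h1,
      concat_joinLeft h1, leftField_mul, annih_concat ha c k t w hw, smul_zero, add_zero, hA,
      colourIncl_leftField]
  exact LinearMap.congr_fun this v

/-- Reversing a concatenated tensor reverses both the order of the letters and each letter
internally. The parameter `r` of `concat` absorbs the internal reversal, and right fields are
thereby reduced to left ones. -/
theorem concat_rev (v : FreeProd (fun _ : K => FreeAlgebra ℂ Side)) :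
    concat mirror (FreeProd.rev v) = mirror (concat LinearMap.id v) := by
  have : concat mirror ∘ₗ FreeProd.rev =
      mirror ∘ₗ (concat (K := K) LinearMap.id) := by
    refine FreeProd.ext_word fun w => ?_
    rw [LinearMap.comp_apply, LinearMap.comp_apply, FreeProd.rev_word, concat_word, concat_word,
      show w.reverse.1 = w.1.reverse from rfl]
    generalize w.1 = l
    induction l with
    | nil => simp
    | cons q l ih =>
      simp only [List.reverse_cons, List.map_append, List.prod_append, ih, List.map_cons,
        List.map_nil, List.prod_cons, List.prod_nil, mul_one, mirror_mul]
      rw [fockLetter, fockLetter, colourIncl, secondQuant_mirror]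
      rfl
  exact LinearMap.congr_fun this v

theorem concat_modelOp (c : Side → Side → ℂ) (q : K × Side)
    (v : FreeProd (fun _ : K => FreeAlgebra ℂ Side)) :
    concat LinearMap.id (modelOp (fun _ => gaussOp c) q v) =
      field (blockCov c) Prod.snd q (concat LinearMap.id v) := by
  obtain ⟨k, t⟩ := q
  cases t with
  | left =>
    exact concat_leftRep rfl (fun _ => rfl) c k Side.left _ (fun z => unital_gaussOp c _ z) v
  | right =>
    change concat LinearMap.id (FreeProd.rev (leftRep k (gaussOp c Side.right) (FreeProd.rev v))) =
      mirror (leftField (blockCov c (k, Side.right)) (k, Side.right)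
        (mirror (concat LinearMap.id v)))
    rw [← mirror_mirror (concat LinearMap.id (FreeProd.rev _)), ← concat_rev, FreeProd.rev_rev,
      concat_leftRep mirror_one aug_mirror c k Side.right, concat_rev]
    intro z
    rw [unital_gaussOp]
    change mirror (mirror _) = _
    rw [mirror_mirror]
    rfl

theorem fockMoment_blockCov (c : Side → Side → ℂ) (w : List (K × Side)) :
    fockMoment (blockCov c) Prod.snd w = modelMoment (fun _ => gaussOp c) w := by
  have key : ∀ w : List (K × Side),
      concat LinearMap.id ((w.map (modelOp fun _ => gaussOp c)).prod FreeProd.vacuum) =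
        (w.map (field (blockCov c) Prod.snd)).prod 1 := by
    intro w
    induction w with
    | nil => simp [FreeProd.vacuum, concat_word, AltWord.nil]
    | cons q w ih =>
      rw [List.map_cons, List.map_cons, List.prod_cons, List.prod_cons, Module.End.mul_apply,
        Module.End.mul_apply, concat_modelOp, ih]
  rw [fockMoment, moment, fockState_apply, ← key, aug_concat fun _ => rfl]
  rfl

theorem isBiFreeMoment_fockMoment (c : Side → Side → ℂ) :
    IsBiFreeMoment.{0} (fockMoment (blockCov (K := K) c) Prod.snd) :=
  ⟨_, _, _, _, fockMoment_blockCov c⟩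

end FockFreeProduct

/-! ### The central limit theorem -/

section CentralLimit

universe u v

variable {A : Type*} [Ring A] [Algebra ℂ A]

/-- Expansion of the moments of linear combinations. -/
theorem moment_sum_ofFn (φ : A →ₗ[ℂ] ℂ) {I J L : Type*} [Fintype L] (Z : I → A) (e : J → L → I)
    (m : J → L → ℂ) {n : ℕ} (u : Fin n → J) :
    moment φ (fun j => ∑ l, m j l • Z (e j l)) (List.ofFn u) =
      ∑ f : Fin n → L, (∏ i, m (u i) (f i)) * moment φ Z (List.ofFn fun i => e (u i) (f i)) := by
  classical
  have h := MultilinearMap.map_sum (φ.compMultilinearMap (MultilinearMap.mkPiAlgebraFin ℂ n A))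
    (fun i (l : L) => m (u i) l • Z (e (u i) l))
  simp only [MultilinearMap.map_smul_univ, LinearMap.compMultilinearMap_apply,
    MultilinearMap.mkPiAlgebraFin_apply, smul_eq_mul] at h
  simp only [moment, List.map_ofFn]
  exact h

theorem gaussMoment_single (c : Side → Side → ℂ) (t : Side) : gaussMoment c [t] = 0 := by
  rw [gaussMoment, fockMoment, moment, fockState_apply]
  cases t <;> simp [field, leftField_apply]

theorem gaussMoment_pair (c : Side → Side → ℂ) (s t : Side) : gaussMoment c [s, t] = c s t := by
  rw [gaussMoment, fockMoment, moment, fockState_apply]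
  cases s <;> cases t <;> simp [field, leftField_apply]

theorem gaussMoment_nil (c : Side → Side → ℂ) : gaussMoment c [] = 1 := by
  rw [gaussMoment, fockMoment, moment, fockState_apply]
  simp

/-- The moments of a bi-free family of identically distributed pairs are invariant under
relabelling. -/
theorem IsBiFreeMoment.relabel {K K' : Type*} {m : List (K' × Side) → ℂ}
    (h : IsBiFreeMoment.{v} m) (hid : ∀ k k' (u : List Side), m (u.map (Prod.mk k)) =
      m (u.map (Prod.mk k'))) {σ τ : K → K'} (hσ : Function.Injective σ)
    (hτ : Function.Injective τ) (w : List (K × Side)) :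
    m (w.map (Prod.map σ id)) = m (w.map (Prod.map τ id)) := by
  classical
  obtain ⟨X, _, _, a, ha⟩ := h
  have hm : IsBiFreeMoment.{v} m := ⟨X, _, _, a, ha⟩
  -- Both sides are compared with one model on `K`, pulled back along `τ`.
  have h₀ := isBiFreeMoment_modelMoment (fun k => a (τ k))
  rw [← h₀.congr hm hσ w, ← h₀.congr hm hτ w]
  · intro k u _
    rw [ha, modelMoment_map_mk, modelMoment_map_mk]
  · intro k u _
    rw [hid (σ k) (τ k), ha, modelMoment_map_mk, modelMoment_map_mk]

/-- The colours used number at most `n`; enlarging their set to exactly `n` elements makes `σ`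
injective on all of `Fin n`. -/
theorem exists_factorization {n : ℕ} (f : Fin n → ℕ) :
    ∃ (h : Fin n → Fin n) (σ : Fin n → ℕ), Function.Injective σ ∧ ∀ i, f i = σ (h i) := by
  classical
  obtain ⟨s, hs, hc⟩ := Infinite.exists_superset_card_eq (Finset.univ.image f) n
    (Finset.card_image_le.trans (by simp))
  let e := s.equivFinOfCardEq hc
  have hf : ∀ i, f i ∈ s := fun i => hs (Finset.mem_image_of_mem f (Finset.mem_univ i))
  exact ⟨fun i => e ⟨f i, hf i⟩, fun j => (e.symm j : ℕ),
    fun i j hij => e.symm.injective (Subtype.ext hij), fun i => by simp⟩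

/-- By relabelling, a moment depends only on the pattern of coincidences among its colours, so
finitely many values occur for fixed `n` and `u`. -/
theorem IsBiFreeMoment.exists_bound {m : List (ℕ × Side) → ℂ} (h : IsBiFreeMoment.{v} m)
    (hid : ∀ k k' (u : List Side), m (u.map (Prod.mk k)) = m (u.map (Prod.mk k')))
    {n : ℕ} (u : Fin n → Side) :
    ∃ C : ℝ, ∀ f : Fin n → ℕ, ‖m (List.ofFn fun i => (f i, u i))‖ ≤ C := by
  refine ⟨∑ g : Fin n → Fin n, ‖m (List.ofFn fun i => ((g i : ℕ), u i))‖, fun f => ?_⟩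
  obtain ⟨g, σ, hσ, hf⟩ := exists_factorization f
  have := h.relabel hid hσ Fin.val_injective (List.ofFn fun i => (g i, u i))
  rw [List.map_ofFn, List.map_ofFn] at this
  have e : (List.ofFn fun i => (f i, u i)) =
      List.ofFn (Prod.map σ id ∘ fun i => (g i, u i)) := by
    congr 1
    funext i
    simp [hf]
  rw [e, this]
  exact Finset.single_le_sum (f := fun g : Fin n → Fin n =>
    ‖m (List.ofFn fun i => ((g i : ℕ), u i))‖) (fun _ _ => norm_nonneg _) (Finset.mem_univ g)

open Classical in
theorem card_small_image_le (n N p : ℕ) :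
    (Finset.univ.filter fun f : Fin n → Fin N => (Finset.univ.image f).card ≤ p ∧ 0 < n).card ≤
      p ^ n * N ^ p := by
  have : (Finset.univ.filter fun f : Fin n → Fin N =>
      (Finset.univ.image f).card ≤ p ∧ 0 < n) ⊆
      (Finset.univ : Finset ((Fin n → Fin p) × (Fin p → Fin N))).image fun q => q.2 ∘ q.1 := by
    intro f hf
    obtain ⟨hp, hn⟩ := (Finset.mem_filter.1 hf).2
    set s := Finset.univ.image f
    have hs : ∀ i, f i ∈ s := fun i => Finset.mem_image_of_mem f (Finset.mem_univ i)
    -- A map with at most `p` values factors through `Fin p`. Slots beyond the image receive the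
    -- default value `f ⟨0, hn⟩`, which is where `0 < n` enters.
    refine Finset.mem_image.2 ⟨(fun i => Fin.castLE hp (s.equivFin ⟨f i, hs i⟩),
      fun j => if hj : (j : ℕ) < s.card then (s.equivFin.symm ⟨j, hj⟩ : Fin N) else f ⟨0, hn⟩),
      Finset.mem_univ _, ?_⟩
    funext i
    simp
  refine (Finset.card_le_card this).trans (Finset.card_image_le.trans ?_)
  simp

theorem count_ofFn {n : ℕ} (f : Fin n → ℕ) (k : ℕ) :
    (List.ofFn f).count k = (Finset.univ.filter fun i => f i = k).card := by
  rw [← Multiset.coe_count]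
  have : ((List.ofFn f : List ℕ) : Multiset ℕ) = Finset.univ.val.map f := by
    simp [Fin.univ_val_map]
  rw [this, Multiset.count_map]
  simp only [Finset.card_def, Finset.filter_val, eq_comm]

/-! ### Comparison of two centred families with equal covariance -/

section

variable {m m' : List (ℕ × Side) → ℂ} (h : IsBiFreeMoment.{u} m) (h' : IsBiFreeMoment.{v} m')
  (h0 : ∀ k t, m [(k, t)] = 0) (h0' : ∀ k t, m' [(k, t)] = 0)
  (h2 : ∀ k s t, m [(k, s), (k, t)] = m' [(k, s), (k, t)])
include h h' h0 h0' h2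

/-- Two centred bi-free families with the same covariance have the same mixed moments, except
possibly for the terms with few colours. -/
theorem card_image_of_moment_ne {n : ℕ} (u : Fin n → Side) (f : Fin n → ℕ)
    (hne : m (List.ofFn fun i => (f i, u i)) ≠ m' (List.ofFn fun i => (f i, u i))) :
    2 * (Finset.univ.image f).card + 1 ≤ n := by
  have hcount : ∀ k, ((List.ofFn fun i => (f i, u i)).map Prod.fst).count k =
      (Finset.univ.filter fun i => f i = k).card := by
    intro k
    rw [List.map_ofFn, ← count_ofFn]
    rfl
  -- A colour occurring exactly once makes both moments vanish.
  have hone : ∀ k, (Finset.univ.filter fun i => f i = k).card ≠ 1 := by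
    intro k hk
    rw [← hcount] at hk
    exact hne ((h.eq_zero hk (h0 k)).trans (h'.eq_zero hk (h0' k)).symm)
  -- If every colour occurred at most twice, only means and covariances would enter, and the two
  -- moments would agree.
  have hthree : ∃ k, 3 ≤ (Finset.univ.filter fun i => f i = k).card := by
    by_contra hcon
    push Not at hcon
    refine hne (h.congr_id h' _ fun k v hv => ?_)
    rw [hcount] at hv
    match v, hv.trans (Nat.le_of_lt_succ (hcon k)) with
    | [], _ => rw [List.map_nil, h.nil, h'.nil]
    | [t], _ => exact (h0 k t).trans (h0' k t).symm
    | [s, t], _ => exact h2 k s t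
  obtain ⟨k, hk⟩ := hthree
  have hsum := Finset.card_eq_sum_card_image f Finset.univ
  rw [Finset.card_fin] at hsum
  have hkm : k ∈ Finset.univ.image f := by
    obtain ⟨i, hi⟩ := Finset.card_pos.1 (by omega : 0 < (Finset.univ.filter fun i => f i = k).card)
    exact Finset.mem_image.2 ⟨i, Finset.mem_univ _, (Finset.mem_filter.1 hi).2⟩
  have hlt : ∑ _k ∈ Finset.univ.image f, 2 <
      ∑ k ∈ Finset.univ.image f, (Finset.univ.filter fun i => f i = k).card := by
    refine Finset.sum_lt_sum (fun j hj => ?_) ⟨k, hkm, by omega⟩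
    obtain ⟨i, -, hi⟩ := Finset.mem_image.1 hj
    have : 0 < (Finset.univ.filter fun i => f i = j).card :=
      Finset.card_pos.2 ⟨i, by simp [hi]⟩
    have := hone j
    omega
  rw [Finset.sum_const, smul_eq_mul, ← hsum] at hlt
  omega

/-- The difference of the moments of the normalized sums is `O(N^{-1/2})`. -/
theorem exists_bound_normalized_sub
    (hid : ∀ k k' (u : List Side), m (u.map (Prod.mk k)) = m (u.map (Prod.mk k')))
    (hid' : ∀ k k' (u : List Side), m' (u.map (Prod.mk k)) = m' (u.map (Prod.mk k')))
    {n : ℕ} (u : Fin n → Side) :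
    ∃ C : ℝ, ∀ N : ℕ, 0 < N →
      ‖∑ f : Fin n → Fin N, ((Real.sqrt N : ℝ) : ℂ)⁻¹ ^ n *
          m (List.ofFn fun i => ((f i : ℕ), u i)) -
        ∑ f : Fin n → Fin N, ((Real.sqrt N : ℝ) : ℂ)⁻¹ ^ n *
          m' (List.ofFn fun i => ((f i : ℕ), u i))‖ ≤ C * (Real.sqrt N)⁻¹ := by
  classical
  obtain ⟨C, hC⟩ := h.exists_bound hid u
  obtain ⟨C', hC'⟩ := h'.exists_bound hid' u
  have hCC : 0 ≤ C + C' := add_nonneg ((norm_nonneg _).trans (hC fun _ => 0))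
    ((norm_nonneg _).trans (hC' fun _ => 0))
  -- The largest number of colours `q` with `2 * q + 1 ≤ n`, for `n > 0`. At most `p ^ n * N ^ p`
  -- terms survive, against the weight `N^{-n/2}`. For `n = 0` truncated subtraction still gives `p
  -- = 0`, and that case is treated apart.
  set p := (n - 1) / 2
  refine ⟨p ^ n * (C + C'), fun N hN => ?_⟩
  have hr : (1 : ℝ) ≤ Real.sqrt N := by
    rw [Real.one_le_sqrt]
    exact_mod_cast hN
  set S := Finset.univ.filter fun f : Fin n → Fin N => (Finset.univ.image f).card ≤ p ∧ 0 < n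
  rw [← Finset.sum_sub_distrib]
  simp only [← mul_sub]
  rw [← Finset.mul_sum]
  have hzero : ∀ f ∈ (Finset.univ : Finset (Fin n → Fin N)), f ∉ S →
      m (List.ofFn fun i => ((f i : ℕ), u i)) - m' (List.ofFn fun i => ((f i : ℕ), u i)) = 0 := by
    intro f _ hf
    by_contra hne
    refine hf (Finset.mem_filter.2 ⟨Finset.mem_univ _, ?_⟩)
    have := card_image_of_moment_ne h h' h0 h0' h2 u (fun i => (f i : ℕ)) (sub_ne_zero.1 hne)
    have e : Finset.univ.image (fun i => (f i : ℕ)) = (Finset.univ.image f).image Fin.val := by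
      rw [Finset.image_image]
      rfl
    rw [e, Finset.card_image_of_injective _ Fin.val_injective] at this
    omega
  rw [← Finset.sum_subset (Finset.subset_univ S) hzero]
  by_cases hn : n = 0
  · have : S = ∅ := by
      simp [S, hn]
    rw [this]
    simp only [Finset.sum_empty, mul_zero, norm_zero]
    positivity
  have hbound : ‖∑ f ∈ S, (m (List.ofFn fun i => ((f i : ℕ), u i)) -
      m' (List.ofFn fun i => ((f i : ℕ), u i)))‖ ≤ (p ^ n * N ^ p : ℝ) * (C + C') := by
    refine (norm_sum_le_of_le S fun f _ => (norm_sub_le _ _).trans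
      (add_le_add (hC fun i => (f i : ℕ)) (hC' fun i => (f i : ℕ)))).trans ?_
    rw [Finset.sum_const, nsmul_eq_mul]
    refine mul_le_mul_of_nonneg_right ?_ hCC
    exact_mod_cast card_small_image_le n N p
  have hpow : ((Real.sqrt N)⁻¹) ^ n * (N : ℝ) ^ p ≤ (Real.sqrt N)⁻¹ := by
    have h1 : (N : ℝ) ^ p = Real.sqrt N ^ (2 * p) := by
      rw [pow_mul, Real.sq_sqrt (Nat.cast_nonneg _)]
    obtain ⟨d, hd⟩ : ∃ d, n = 2 * p + 1 + d := ⟨n - (2 * p + 1), by omega⟩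
    have h2 : (Real.sqrt N)⁻¹ ^ (2 * p) * Real.sqrt N ^ (2 * p) = 1 := by
      rw [← mul_pow, inv_mul_cancel₀ (by positivity), one_pow]
    have h3 : (Real.sqrt N)⁻¹ ^ d ≤ 1 := pow_le_one₀ (by positivity) (inv_le_one_of_one_le₀ hr)
    calc (Real.sqrt N)⁻¹ ^ n * (N : ℝ) ^ p
        = ((Real.sqrt N)⁻¹ ^ (2 * p) * Real.sqrt N ^ (2 * p)) * (Real.sqrt N)⁻¹ *
          (Real.sqrt N)⁻¹ ^ d := by
          rw [h1]
          conv_lhs => rw [hd]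
          ring
      _ ≤ (Real.sqrt N)⁻¹ := by
          rw [h2, one_mul]
          exact mul_le_of_le_one_right (by positivity) h3
  rw [norm_mul, norm_pow, norm_inv, Complex.norm_real, Real.norm_of_nonneg (by positivity)]
  calc (Real.sqrt N)⁻¹ ^ n * ‖∑ f ∈ S, (m (List.ofFn fun i => ((f i : ℕ), u i)) -
        m' (List.ofFn fun i => ((f i : ℕ), u i)))‖
      ≤ (Real.sqrt N)⁻¹ ^ n * ((p ^ n * N ^ p : ℝ) * (C + C')) :=
        mul_le_mul_of_nonneg_left hbound (by positivity)
    _ = (p ^ n * (C + C')) * ((Real.sqrt N)⁻¹ ^ n * (N : ℝ) ^ p) := by ring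
    _ ≤ _ := mul_le_mul_of_nonneg_left hpow (by positivity)

end

/-- A normalized sum of bi-free Gaussian pairs is a Gaussian pair. -/
theorem gaussMoment_normalized (c : Side → Side → ℂ) {N : ℕ} (hN : 0 < N) (u : List Side) :
    moment fockState (fun t => ∑ l : Fin N, ((Real.sqrt N : ℝ) : ℂ)⁻¹ •
      field (blockCov c) Prod.snd ((l : ℕ), t)) u = gaussMoment c u := by
  refine (fockMoment_eq_sum (T := (Finset.univ : Finset (Fin N))) (e := fun t l => ((l : ℕ), t))
    (m := fun _ _ => ((Real.sqrt N : ℝ) : ℂ)⁻¹) (C := blockCov c) (s := Prod.snd) (C' := c)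
    (s' := id) (fun _ _ _ => rfl) (fun s t => ?_) u).symm
  have hr : ((Real.sqrt N : ℝ) : ℂ)⁻¹ * ((Real.sqrt N : ℝ) : ℂ)⁻¹ = (N : ℂ)⁻¹ := by
    rw [← mul_inv, ← Complex.ofReal_mul, Real.mul_self_sqrt (Nat.cast_nonneg _),
      Complex.ofReal_natCast]
  have hN' : (N : ℂ) ≠ 0 := by exact_mod_cast hN.ne'
  simp only [blockCov, hr, Fin.val_inj, mul_ite, mul_zero, Finset.sum_ite_eq, Finset.mem_univ,
    if_true, Finset.sum_const, Finset.card_univ, Fintype.card_fin, nsmul_eq_mul]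
  rw [← mul_assoc, mul_inv_cancel₀ hN', one_mul]

/-- The bi-free central limit theorem. -/
theorem tendsto_moment_normalized {φ : A →ₗ[ℂ] ℂ} {Z : ℕ × Side → A}
    (h : IsBiFreeMoment.{v} (moment φ Z))
    (hid : ∀ k (u : List Side), moment φ Z (u.map (Prod.mk k)) = moment φ Z (u.map (Prod.mk 0)))
    (h0 : ∀ t, moment φ Z [(0, t)] = 0) (u : List Side) :
    Filter.Tendsto (fun N : ℕ => moment φ (fun t => ∑ l : Fin N, ((Real.sqrt N : ℝ) : ℂ)⁻¹ •
      Z ((l : ℕ), t)) u) Filter.atTop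
      (nhds (gaussMoment (fun s t => moment φ Z [(0, s), (0, t)]) u)) := by
  set c : Side → Side → ℂ := fun s t => moment φ Z [(0, s), (0, t)] with hc
  have hmarg : ∀ k (u : List Side), fockMoment (blockCov c) Prod.snd (u.map (Prod.mk k)) =
      gaussMoment c u := fockMoment_blockCov_map_mk (K := ℕ) c
  obtain ⟨v, hv⟩ : ∃ v : Fin u.length → Side, List.ofFn v = u := ⟨u.get, List.ofFn_get u⟩
  obtain ⟨C, hC⟩ := exists_bound_normalized_sub h (isBiFreeMoment_fockMoment (K := ℕ) c)
    (fun k t => (hid k [t]).trans (h0 t))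
    (fun k t => (hmarg k [t]).trans (gaussMoment_single c t))
    (fun k s t => (hid k [s, t]).trans ((hmarg k [s, t]).trans (gaussMoment_pair c s t)).symm)
    (fun k k' u => (hid k u).trans (hid k' u).symm)
    (fun k k' u => (hmarg k u).trans (hmarg k' u).symm) v
  rw [← tendsto_sub_nhds_zero_iff]
  have hlim : Filter.Tendsto (fun N : ℕ => C * (Real.sqrt N)⁻¹) Filter.atTop (nhds 0) := by
    rw [← mul_zero C]
    exact (tendsto_inv_atTop_zero.comp
      (Real.tendsto_sqrt_atTop.comp tendsto_natCast_atTop_atTop)).const_mul C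
  refine squeeze_zero_norm' ?_ hlim
  filter_upwards [Filter.eventually_gt_atTop 0] with N hN
  refine le_trans (le_of_eq ?_) (hC N hN)
  -- The limit is itself the moment of a normalized sum of `N` Gaussian pairs, so the two sums can
  -- be compared term by term.
  rw [← gaussMoment_normalized c hN u]
  conv_lhs => rw [← hv]
  rw [moment_sum_ofFn φ Z (fun t (l : Fin N) => ((l : ℕ), t)),
    moment_sum_ofFn fockState _ (fun t (l : Fin N) => ((l : ℕ), t))]
  simp only [Finset.prod_const, Finset.card_univ, Fintype.card_fin]
  rfl

end CentralLimit

/-! ### Gaussian pairs and central limit distributions -/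

section Gaussian

universe u

variable {A : Type u} [Ring A] [Algebra ℂ A] {φ : A →ₗ[ℂ] ℂ}

theorem twoFaced_normalized (T S : ℕ → A) (r : ℂ) (N : ℕ) :
    twoFaced (r • ∑ i ∈ Finset.range N, T i) (r • ∑ i ∈ Finset.range N, S i) =
      fun t => ∑ l : Fin N, r • facePair T S ((l : ℕ), t) := by
  funext t
  cases t <;> simp [twoFaced, facePair, Finset.smul_sum, Finset.sum_range]

/-- Central limit distributions are Gaussian. -/
theorem IsBiFreeCentralLimit.exists_gaussMoment {T S : A} (h : IsBiFreeCentralLimit φ T S) :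
    ∃ c, ∀ u, moment φ (twoFaced T S) u = gaussMoment c u := by
  obtain ⟨A', _, _, φ', T', S', h1, hbf, hid, h0, hlim⟩ := h
  have hm := hbf.isBiFreeMoment
  refine ⟨_, fun u => tendsto_nhds_unique ?_ (tendsto_moment_normalized hm ?_ ?_ u)⟩
  · have := hlim (u.map (FreeAlgebra.ι ℂ)).prod
    simpa only [jointDistribution_words, twoFaced_normalized] using this
  · intro k u
    rw [moment_facePair_map_mk, moment_facePair_map_mk, ← jointDistribution_words,
      ← jointDistribution_words, hid k]
  · intro t
    cases t
    · simpa [moment, facePair, twoFaced] using (h0 0).1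
    · simpa [moment, facePair, twoFaced] using (h0 0).2

theorem jointDistribution_eq {B : Type*} [Ring B] [Algebra ℂ B] {ψ : B →ₗ[ℂ] ℂ} {T S : A}
    {T' S' : B} (h : ∀ u, moment φ (twoFaced T S) u = moment ψ (twoFaced T' S') u) :
    jointDistribution φ T S = jointDistribution ψ T' S' :=
  freeAlgebra_hom_ext_words fun u => by
    rw [jointDistribution_words, jointDistribution_words, h]

/-- Gaussian pairs have central limit distributions. -/
theorem isBiFreeCentralLimit_of_gaussMoment (hφ : φ 1 = 1) {T S : A} {c : Side → Side → ℂ}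
    (h : ∀ u, moment φ (twoFaced T S) u = gaussMoment c u) : IsBiFreeCentralLimit φ T S := by
  -- The independent copies are taken on a free product of copies of `A`, which remains in the
  -- universe of `A`; a Fock space over `ℕ × Side` would not in general.
  let X : ℕ → Type u := fun _ => LinearMap.ker φ
  let a : ∀ k : ℕ, Side → Module.End ℂ (ℂ × X k) := fun _ t => standardRep hφ (twoFaced T S t)
  let φ' : Module.End ℂ (FreeProd X) →ₗ[ℂ] ℂ :=
    FreeProd.proj ∘ₗ LinearMap.applyₗ FreeProd.vacuum
  let T' : ℕ → Module.End ℂ (FreeProd X) := fun i => modelOp a (i, Side.left)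
  let S' : ℕ → Module.End ℂ (FreeProd X) := fun i => modelOp a (i, Side.right)
  have hZ : facePair T' S' = modelOp a := by
    funext ⟨k, t⟩
    cases t <;> rfl
  have hm : IsBiFreeMoment.{u} (moment φ' (facePair T' S')) := by
    rw [hZ]
    exact isBiFreeMoment_modelMoment a
  have hmarg : ∀ k u, moment φ' (facePair T' S') (u.map (Prod.mk k)) = gaussMoment c u := by
    intro k u
    rw [hZ, ← h u, ← orbit_standardRep hφ]
    exact modelMoment_map_mk a k u
  have hfock : ∀ w, moment φ' (facePair T' S') w =
      moment fockState (field (blockCov c) Prod.snd) w := fun w =>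
    hm.congr_id (isBiFreeMoment_fockMoment c) w fun k u _ =>
      (hmarg k u).trans (fockMoment_blockCov_map_mk c k u).symm
  have h1 : φ' 1 = 1 := hm.nil
  refine ⟨Module.End ℂ (FreeProd X), inferInstance, inferInstance, φ', T', S', h1,
    isBiFreeFamily_of_isBiFreeMoment h1 hm, fun i => jointDistribution_eq fun u => ?_,
    fun i => ⟨?_, ?_⟩, fun P => ?_⟩
  · rw [← moment_facePair_map_mk, ← moment_facePair_map_mk, hmarg, hmarg]
  · have := (hmarg i [Side.left]).trans (gaussMoment_single c _)
    simpa [moment, facePair, twoFaced] using this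
  · have := (hmarg i [Side.right]).trans (gaussMoment_single c _)
    simpa [moment, facePair, twoFaced] using this
  -- By stability of Gaussian pairs the sequence is constant for `N > 0`.
  · refine tendsto_const_nhds.congr' ?_
    filter_upwards [Filter.eventually_gt_atTop 0] with N hN
    refine LinearMap.congr_fun (jointDistribution_eq fun u => ?_) P
    have := moment_lift_eq hfock (fun t : Side => ∑ l : Fin N, ((Real.sqrt N : ℝ) : ℂ)⁻¹ •
      FreeAlgebra.ι ℂ ((l : ℕ), t)) u
    simp only [map_sum, map_smul, FreeAlgebra.lift_ι_apply] at this
    rw [twoFaced_normalized, this, gaussMoment_normalized c hN, h]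

end Gaussian

/-! ### Second-order cumulants -/

section SecondCumulants

variable {A : Type*} [Ring A] [Algebra ℂ A] {φ : A →ₗ[ℂ] ℂ}

theorem equalSecondCumulants_of_moment_eq {T₁ S₁ T₂ S₂ : A}
    (h : ∀ u, moment φ (twoFaced T₁ S₁) u = moment φ (twoFaced T₂ S₂) u) :
    EqualSecondCumulants φ T₁ S₁ T₂ S₂ := by
  intro χ
  unfold cumulant momentPart
  refine Finset.sum_congr rfl fun σ _ => ?_
  congr 1
  refine Finset.prod_congr rfl fun V _ => ?_
  have := h ((V.sort (· ≤ ·)).map χ)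
  rw [moment, moment, List.map_map, List.map_map] at this
  exact this

/-- Any partition of two points other than the one-block partition has a singleton block, whose
factor is a mean. Hence the second cumulants of centred variables are their second moments. -/
theorem momentPart_eq_zero {χ : Fin 2 → Side} {σ : BNC χ} (hσ : σ ≠ BNC.one χ) (Z : Fin 2 → A)
    (hZ : ∀ i, φ (Z i) = 0) : momentPart φ σ Z = 0 := by
  obtain ⟨V, hV, hc⟩ : ∃ V ∈ σ.1.parts, V.card < 2 := by
    by_contra hcon
    push Not at hcon
    have huniv : ∀ V ∈ σ.1.parts, V = Finset.univ := fun V hV =>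
      Finset.eq_univ_of_card V (le_antisymm (Finset.card_le_univ V) (by simpa using hcon V hV))
    refine hσ (Subtype.ext (top_le_iff.1 fun W hW => ?_))
    obtain ⟨V, hV⟩ := σ.1.parts_nonempty Finset.univ_nonempty.ne_empty
    exact ⟨V, hV, by rw [huniv V hV]; exact Finset.subset_univ W⟩
  obtain ⟨i, rfl⟩ := Finset.card_eq_one.1 (by
    have := Finset.card_pos.2 (σ.1.nonempty_of_mem_parts hV)
    omega : V.card = 1)
  exact Finset.prod_eq_zero hV (by simp [hZ])

theorem momentPart_one (χ : Fin 2 → Side) (Z : Fin 2 → A) :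
    momentPart φ (BNC.one χ) Z = φ (Z 0 * Z 1) := by
  have hp : (BNC.one χ).1.parts = {Finset.univ} := by
    have hsub := Finpartition.parts_top_subset (Finset.univ : Finset (Fin 2))
    obtain ⟨V, hV⟩ := (⊤ : Finpartition (Finset.univ : Finset (Fin 2))).parts_nonempty
      Finset.univ_nonempty.ne_empty
    refine Finset.Subset.antisymm hsub ?_
    rw [Finset.singleton_subset_iff]
    have := Finset.mem_singleton.1 (hsub hV)
    rwa [this] at hV
  have hs : (Finset.univ : Finset (Fin 2)).sort (· ≤ ·) = [0, 1] := by
    rw [Fin.sort_univ]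
    rfl
  rw [momentPart, hp, Finset.prod_singleton, hs]
  simp

theorem cumulant_one_of_centred (χ : Fin 2 → Side) (Z : Fin 2 → A) (hZ : ∀ i, φ (Z i) = 0) :
    cumulant φ (BNC.one χ) Z = φ (Z 0 * Z 1) := by
  classical
  rw [cumulant, Finset.sum_eq_single (BNC.one χ), momentPart_one, muBNC, IncidenceAlgebra.mu_self,
    mul_one]
  · intro σ _ hσ
    rw [momentPart_eq_zero hσ Z hZ, zero_mul]
  · intro h
    exact absurd (by simp) h

theorem EqualSecondCumulants.pair_eq {T₁ S₁ T₂ S₂ : A} (h : EqualSecondCumulants φ T₁ S₁ T₂ S₂)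
    (h₁ : ∀ t, φ (twoFaced T₁ S₁ t) = 0) (h₂ : ∀ t, φ (twoFaced T₂ S₂ t) = 0) (s t : Side) :
    φ (twoFaced T₁ S₁ s * twoFaced T₁ S₁ t) = φ (twoFaced T₂ S₂ s * twoFaced T₂ S₂ t) := by
  have := h ![s, t]
  rw [cumulant_one_of_centred _ _ fun _ => h₁ _, cumulant_one_of_centred _ _ fun _ => h₂ _] at this
  simpa using this

end SecondCumulants

/-! ### Rotations -/

section Rotation

universe u v

variable {A : Type*} [Ring A] [Algebra ℂ A]

/-- The coefficients of a rotation. -/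
def rot (a b : ℂ) : Fin 2 → Fin 2 → ℂ := ![![a, b], ![-b, a]]

/-- The rotated family of variables. -/
def rotated (a b : ℂ) (Z : Fin 2 × Side → A) (q : Fin 2 × Side) : A :=
  ∑ l : Fin 2, rot a b q.1 l • Z (l, q.2)

theorem lift_rotated (a b : ℂ) (Z : Fin 2 × Side → A) :
    (fun q => FreeAlgebra.lift ℂ Z (rotated a b (FreeAlgebra.ι ℂ) q)) = rotated a b Z := by
  funext q
  simp only [rotated, map_sum, map_smul, FreeAlgebra.lift_ι_apply]

theorem moment_rotated_congr {B : Type*} [Ring B] [Algebra ℂ B] {φ : A →ₗ[ℂ] ℂ} {ψ : B →ₗ[ℂ] ℂ}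
    {Z : Fin 2 × Side → A} {Y : Fin 2 × Side → B} (a b : ℂ)
    (h : ∀ w, moment φ Z w = moment ψ Y w) (w : List (Fin 2 × Side)) :
    moment φ (rotated a b Z) w = moment ψ (rotated a b Y) w := by
  have := moment_lift_eq h (rotated a b (FreeAlgebra.ι ℂ)) w
  rwa [lift_rotated, lift_rotated] at this

/-- The Gaussian moments are invariant under rotations. -/
theorem fockMoment_rotated {a b : ℂ} (hab : a ^ 2 + b ^ 2 = 1) (c : Side → Side → ℂ)
    (w : List (Fin 2 × Side)) :
    moment fockState (rotated a b (field (blockCov c) Prod.snd)) w =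
      fockMoment (blockCov c) Prod.snd w := by
  -- Orthogonality of the rotation matrix: it preserves the identity in the colour indices, which
  -- multiplies `c`.
  have hC : ∀ p q : Fin 2 × Side, blockCov c p q = ∑ l : Fin 2, ∑ l' : Fin 2,
      rot a b p.1 l * rot a b q.1 l' * blockCov c (l, p.2) (l', q.2) := by
    rintro ⟨i, s⟩ ⟨j, t⟩
    fin_cases i <;> fin_cases j <;> simp [blockCov, rot, Fin.sum_univ_two] <;>
      first | ring1 | linear_combination (-c s t) * hab
  exact (fockMoment_eq_sum (e := fun (q : Fin 2 × Side) (l : Fin 2) => (l, q.2))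
    (m := fun (q : Fin 2 × Side) (l : Fin 2) => rot a b q.1 l) (s := Prod.snd)
    (s' := Prod.snd) (fun _ _ _ => rfl) hC w).symm

theorem moment_rotated_ofFn (φ : A →ₗ[ℂ] ℂ) (Z : Fin 2 × Side → A) (a b : ℂ) {n : ℕ}
    (τ : Fin n → Fin 2) (u : Fin n → Side) :
    moment φ (rotated a b Z) (List.ofFn fun i => (τ i, u i)) =
      ∑ f : Fin n → Fin 2, (∏ i, rot a b (τ i) (f i)) *
        moment φ Z (List.ofFn fun i => (f i, u i)) :=
  moment_sum_ofFn φ Z (fun (q : Fin 2 × Side) (l : Fin 2) => (l, q.2))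
    (fun q l => rot a b q.1 l) fun i => (τ i, u i)

theorem count_ofFn_lt {n : ℕ} {f : Fin n → Fin 2} {k : Fin 2} {i : Fin n} (hi : f i ≠ k)
    (u : Fin n → Side) : ((List.ofFn fun i => (f i, u i)).map Prod.fst).count k < n := by
  have hlen : ((List.ofFn fun i => (f i, u i)).map Prod.fst).length = n := by simp
  refine lt_of_le_of_ne (List.count_le_length.trans hlen.le) fun h => ?_
  have := (List.count_eq_length.1 (h.trans hlen.symm)) (f i) (by
    rw [List.map_ofFn, List.mem_ofFn]
    exact ⟨i, rfl⟩)
  exact hi this.symm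

section

variable {φ : A →ₗ[ℂ] ℂ} {Z : Fin 2 × Side → A} {a b : ℂ} (hab : a ^ 2 + b ^ 2 = 1)
  (hm : IsBiFreeMoment.{u} (moment φ Z)) (hm' : IsBiFreeMoment.{v} (moment φ (rotated a b Z)))
  {c : Side → Side → ℂ} {n : ℕ}
  (ih : ∀ v : List Side, v.length < n → ∀ k, moment φ Z (v.map (Prod.mk k)) = gaussMoment c v)
include hab hm hm' ih

/-- If the moments of order less than `n` are Gaussian, then each word in the rotated variables
gives a linear relation between the deviations of the moments of order `n`. -/
theorem rotation_relation (u : Fin n → Side) (τ : Fin n → Fin 2) {i₀ i₁ : Fin n}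
    (hi₀ : τ i₀ = 0) (hi₁ : τ i₁ = 1) :
    (∏ i, rot a b (τ i) 0) *
        (moment φ Z ((List.ofFn u).map (Prod.mk 0)) - gaussMoment c (List.ofFn u)) +
      (∏ i, rot a b (τ i) 1) *
        (moment φ Z ((List.ofFn u).map (Prod.mk 1)) - gaussMoment c (List.ofFn u)) = 0 := by
  have hF := isBiFreeMoment_fockMoment (K := Fin 2) c
  have hlow : ∀ w : List (Fin 2 × Side), (∀ k, (w.map Prod.fst).count k < n) →
      moment φ Z w = fockMoment (blockCov c) Prod.snd w := fun w hw =>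
    hm.congr_id hF w fun k v hv => by
      rw [ih v (hv.trans_lt (hw k)), fockMoment_blockCov_map_mk]
  have hlow' : ∀ w : List (Fin 2 × Side), w.length < n →
      moment φ (rotated a b Z) w = fockMoment (blockCov c) Prod.snd w := by
    intro w hw
    rw [← fockMoment_rotated hab]
    obtain ⟨p, f, rfl⟩ : ∃ (p : ℕ) (f : Fin p → Fin 2 × Side), List.ofFn f = w :=
      ⟨w.length, w.get, List.ofFn_get w⟩
    have e : f = fun i => ((f i).1, (f i).2) := rfl
    rw [e, moment_rotated_ofFn, moment_rotated_ofFn]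
    refine Finset.sum_congr rfl fun g _ => ?_
    congr 1
    refine hlow _ fun k => List.count_le_length.trans_lt ?_
    simpa using hw
  -- Since `τ` takes both values, each rotated colour occurs fewer than `n` times. Comparison for
  -- the rotated family then needs only moments of lower order, which are Gaussian by `hlow'`.
  have hmixed : moment φ (rotated a b Z) (List.ofFn fun i => (τ i, u i)) =
      moment fockState (rotated a b (field (blockCov c) Prod.snd))
        (List.ofFn fun i => (τ i, u i)) := by
    rw [fockMoment_rotated hab]
    refine hm'.congr_id hF _ fun k v hv => hlow' _ ?_
    rw [List.length_map]
    refine hv.trans_lt ?_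
    fin_cases k
    · exact count_ofFn_lt (i := i₁) (by simp [hi₁]) u
    · exact count_ofFn_lt (i := i₀) (by simp [hi₀]) u
  rw [moment_rotated_ofFn, moment_rotated_ofFn, ← sub_eq_zero, ← Finset.sum_sub_distrib] at hmixed
  simp only [← mul_sub] at hmixed
  have hne : (fun _ : Fin n => (0 : Fin 2)) ≠ fun _ => 1 := fun h =>
    zero_ne_one (congrFun h i₀)
  -- In the expansion every nonconstant choice of colours involves lower marginal moments only and
  -- cancels; the two constant choices give the deviations.
  rw [← Finset.sum_subset (Finset.subset_univ {(fun _ => (0 : Fin 2)), fun _ => 1}),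
    Finset.sum_pair hne] at hmixed
  · have e : ∀ k : Fin 2, (List.ofFn fun i => (k, u i)) = (List.ofFn u).map (Prod.mk k) := by
      intro k
      rw [List.map_ofFn]
      rfl
    rw [e, e] at hmixed
    have hg : ∀ k : Fin 2, moment fockState (field (blockCov c) Prod.snd)
        ((List.ofFn u).map (Prod.mk k)) = gaussMoment c (List.ofFn u) := fun k =>
      fockMoment_blockCov_map_mk c k _
    rwa [hg, hg] at hmixed
  · intro f _ hf
    simp only [Finset.mem_insert, Finset.mem_singleton, not_or] at hf
    have h1 : ∃ i, f i ≠ 0 := Function.ne_iff.1 hf.1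
    have h2 : ∃ i, f i ≠ 1 := Function.ne_iff.1 hf.2
    rw [hlow _ fun k => ?_]
    · rw [fockMoment, sub_self, mul_zero]
    · fin_cases k
      · exact count_ofFn_lt h1.choose_spec u
      · exact count_ofFn_lt h2.choose_spec u

end

/-- If both a centred bi-free pair of two-faced families and its rotation are bi-free, then the
marginals are Gaussian with the same covariance. -/
theorem moment_eq_gaussMoment_of_rotated {φ : A →ₗ[ℂ] ℂ} {Z : Fin 2 × Side → A} {a b : ℂ}
    (hab : a ^ 2 + b ^ 2 = 1) (ha : a ≠ 0) (hb : b ≠ 0) (hm : IsBiFreeMoment.{u} (moment φ Z))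
    (hm' : IsBiFreeMoment.{v} (moment φ (rotated a b Z))) (h0 : ∀ q, φ (Z q) = 0) (w : List Side) :
    ∀ k, moment φ Z (w.map (Prod.mk k)) =
      gaussMoment (fun s t => moment φ Z [(0, s), (0, t)]) w := by
  induction hn : w.length using Nat.strong_induction_on generalizing w with
  | _ n ih =>
    have ih' : ∀ v : List Side, v.length < n → ∀ k, moment φ Z (v.map (Prod.mk k)) =
        gaussMoment (fun s t => moment φ Z [(0, s), (0, t)]) v := fun v hv => ih _ hv v rfl
    obtain ⟨u, rfl⟩ : ∃ u : Fin n → Side, List.ofFn u = w := by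
      subst hn
      exact ⟨w.get, List.ofFn_get w⟩
    have key := rotation_relation hab hm hm' ih' u
    match n, u, key with
    | 0, u, _ =>
      intro k
      rw [List.ofFn_zero, List.map_nil, hm.nil, gaussMoment_nil]
    | 1, u, _ =>
      intro k
      simp [gaussMoment_single, moment, h0]
    -- The covariance is that of colour `0`, so its deviation is zero by definition, and one
    -- relation with coefficient `a * b` settles colour `1`.
    | 2, u, key =>
      have h₀ : moment φ Z ((List.ofFn u).map (Prod.mk 0)) =
          gaussMoment (fun s t => moment φ Z [(0, s), (0, t)]) (List.ofFn u) := by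
        simp [gaussMoment_pair]
      have e := key ![1, 0] (i₀ := 1) (i₁ := 0) rfl rfl
      rw [h₀, sub_self, mul_zero, zero_add] at e
      simp only [Fin.prod_univ_two, rot, Matrix.cons_val_zero, Matrix.cons_val_one] at e
      have h₁ := sub_eq_zero.1 ((mul_eq_zero.1 e).resolve_left (mul_ne_zero ha hb))
      intro k
      fin_cases k
      · exact h₀
      · exact h₁
    | k + 3, u, key =>
      -- The words with one and with two entries of rotated colour `1`; order at least three leaves
      -- an entry of colour `0` in both. Eliminating one deviation leaves the other times a nonzero
      -- multiple of `a ^ 2 + b ^ 2 = 1`.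
      have e₁ := key (Fin.cons 1 fun _ => 0) (i₀ := 1) (i₁ := 0) rfl rfl
      have e₂ := key (Fin.cons 1 (Fin.cons 1 fun _ => 0)) (i₀ := 2) (i₁ := 0) rfl rfl
      simp only [Fin.prod_univ_succ (n := k + 2), Fin.prod_univ_succ (n := k + 1), Fin.cons_zero,
        Fin.cons_succ, Finset.prod_const, Finset.card_univ, Fintype.card_fin, rot,
        Matrix.cons_val_zero, Matrix.cons_val_one] at e₁ e₂
      set D₀ := moment φ Z ((List.ofFn u).map (Prod.mk 0)) -
        gaussMoment (fun s t => moment φ Z [(0, s), (0, t)]) (List.ofFn u) with hD₀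
      set D₁ := moment φ Z ((List.ofFn u).map (Prod.mk 1)) -
        gaussMoment (fun s t => moment φ Z [(0, s), (0, t)]) (List.ofFn u) with hD₁
      have h₀ : b * a ^ (k + 1) * D₀ = 0 := by
        linear_combination (-a) * e₁ + b * e₂ - b * a ^ (k + 1) * D₀ * hab
      have h₁ : a * b ^ (k + 1) * D₁ = 0 := by
        linear_combination b * e₁ + a * e₂ - a * b ^ (k + 1) * D₁ * hab
      have h₀' := (mul_eq_zero.1 h₀).resolve_left (mul_ne_zero hb (pow_ne_zero _ ha))
      have h₁' := (mul_eq_zero.1 h₁).resolve_left (mul_ne_zero ha (pow_ne_zero _ hb))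
      intro j
      fin_cases j
      · exact sub_eq_zero.1 h₀'
      · exact sub_eq_zero.1 h₁'

theorem facePair_rotated (T₁ S₁ T₂ S₂ : A) (a b : ℂ) :
    facePair ![a • T₁ + b • T₂, -b • T₁ + a • T₂] ![a • S₁ + b • S₂, -b • S₁ + a • S₂] =
      rotated a b (facePair ![T₁, T₂] ![S₁, S₂]) := by
  funext ⟨k, t⟩
  fin_cases k <;> cases t <;> simp [rotated, rot, facePair, twoFaced, Fin.sum_univ_two]

end Rotation

end BiFree

/-! ### The bi-free Kac/Loève theorem -/

theorem mainTheorem2 {A : Type*} [Ring A] [Algebra ℂ A] (φ : A →ₗ[ℂ] ℂ) (hφ : φ 1 = 1)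
    (T₁ S₁ T₂ S₂ T₃ S₃ T₄ S₄ : A)
    (hbf : BiFree.IsBiFreeFamily φ ![T₁, T₂] ![S₁, S₂])
    (θ : ℝ) (hθ : θ ∈ Set.Ioo 0 (Real.pi / 2))
    (hT₃ : T₃ = (Real.cos θ : ℂ) • T₁ + (Real.sin θ : ℂ) • T₂)
    (hS₃ : S₃ = (Real.cos θ : ℂ) • S₁ + (Real.sin θ : ℂ) • S₂)
    (hT₄ : T₄ = -(Real.sin θ : ℂ) • T₁ + (Real.cos θ : ℂ) • T₂)
    (hS₄ : S₄ = -(Real.sin θ : ℂ) • S₁ + (Real.cos θ : ℂ) • S₂) :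
    (φ T₁ = 0 → φ S₁ = 0 → φ T₂ = 0 → φ S₂ = 0 →
      BiFree.IsBiFreeFamily φ ![T₃, T₄] ![S₃, S₄] →
        BiFree.IsBiFreeCentralLimit φ T₁ S₁ ∧ BiFree.IsBiFreeCentralLimit φ T₂ S₂ ∧
          BiFree.EqualSecondCumulants φ T₁ S₁ T₂ S₂) ∧
    (BiFree.IsBiFreeCentralLimit φ T₁ S₁ → BiFree.IsBiFreeCentralLimit φ T₂ S₂ →
      BiFree.EqualSecondCumulants φ T₁ S₁ T₂ S₂ →
        BiFree.IsBiFreeFamily φ ![T₃, T₄] ![S₃, S₄]) := by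
  open BiFree in
  subst hT₃ hS₃ hT₄ hS₄
  have hab : (Real.cos θ : ℂ) ^ 2 + (Real.sin θ : ℂ) ^ 2 = 1 := by
    exact_mod_cast Real.cos_sq_add_sin_sq θ
  have hcos : (Real.cos θ : ℂ) ≠ 0 := by
    exact_mod_cast (Real.cos_pos_of_mem_Ioo ⟨by linarith [hθ.1, hθ.2], hθ.2⟩).ne'
  have hsin : (Real.sin θ : ℂ) ≠ 0 := by
    exact_mod_cast (Real.sin_pos_of_pos_of_lt_pi hθ.1 (by linarith [hθ.1, hθ.2])).ne'
  have hm := hbf.isBiFreeMoment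
  constructor
  · intro hT₁ hS₁ hT₂ hS₂ hbf'
    have hm' := hbf'.isBiFreeMoment
    rw [facePair_rotated] at hm'
    have hg := moment_eq_gaussMoment_of_rotated hab hcos hsin hm hm' (by
      rintro ⟨k, t⟩
      fin_cases k <;> cases t <;> simpa [facePair, twoFaced])
    simp only [moment_facePair_map_mk] at hg
    have h₁ := fun u => hg u 0
    have h₂ := fun u => hg u 1
    exact ⟨isBiFreeCentralLimit_of_gaussMoment hφ h₁, isBiFreeCentralLimit_of_gaussMoment hφ h₂,
      equalSecondCumulants_of_moment_eq fun u => (h₁ u).trans (h₂ u).symm⟩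
  · intro hc₁ hc₂ heq
    obtain ⟨c₁, h₁⟩ := hc₁.exists_gaussMoment
    obtain ⟨c₂, h₂⟩ := hc₂.exists_gaussMoment
    have hc : c₁ = c₂ := by
      funext s t
      -- The means vanish because the pairs are already known to be Gaussian, so equal cumulants
      -- mean equal second moments, and these are the covariances.
      have := heq.pair_eq
        (fun t => by simpa [moment, gaussMoment_single] using h₁ [t])
        (fun t => by simpa [moment, gaussMoment_single] using h₂ [t]) s t
      rw [← gaussMoment_pair c₁ s t, ← gaussMoment_pair c₂ s t, ← h₁, ← h₂]
      simpa [moment] using this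
    subst hc
    have hfock : ∀ w, moment φ (facePair ![T₁, T₂] ![S₁, S₂]) w =
        moment fockState (field (blockCov c₁) Prod.snd) w := fun w =>
      hm.congr_id (isBiFreeMoment_fockMoment c₁) w fun k u _ => by
        rw [moment_facePair_map_mk, fockMoment_blockCov_map_mk]
        fin_cases k
        · exact h₁ u
        · exact h₂ u
    -- It suffices to identify the rotated moments with those of a bi-free Gaussian family, whose
    -- Fock model lives in universe `0`.
    refine isBiFreeFamily_of_isBiFreeMoment.{_, 0} hφ ?_
    rw [facePair_rotated]
    have : moment φ (rotated (Real.cos θ : ℂ) (Real.sin θ : ℂ) (facePair ![T₁, T₂] ![S₁, S₂])) =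
        fockMoment (blockCov c₁) Prod.snd := by
      funext w
      rw [moment_rotated_congr _ _ hfock, fockMoment_rotated hab]
    rw [this]
    exact isBiFreeMoment_fockMoment c₁
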